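/- For $\phi\in(0,\pi)$ let $\Omega_\phi=\{(r\cos\theta,r\sin\theta): r>0,\ 0<\theta<\phi\}\subset\mathbb R^2$ be the wedge of aperture $\phi$, let $\mathbf A(x_1,x_2)=\tfrac12(-x_2,x_1)$, and let $\nabla_{\mathbf A}=i\nabla+\mathbf A$ in the sense of distributions. The magnetic Neumann Laplacian $\mathsf H_{\mathrm N,\phi}$ on $\Omega_\phi$ is the self-adjoint operator in $L^2(\Omega_\phi)$ associated, via the first representation theorem, with the closed non-negative quadratic form $u\mapsto\|\nabla_{\mathbf A}u\|^2_{L^2(\Omega_\phi;\mathbb C^2)}$ on the domain $H^1_{\mathbf A}(\Omega_\phi)=\{u\in L^2(\Omega_\phi):\nabla_{\mathbf A}u\in L^2(\Omega_\phi;\mathbb C^2)\}$. Its discrete spectrum $\sigma_{\mathrm d}$ is the set of isolated points of the spectrum that are eigenvalues of finite multiplicity, its essential spectrum is $\sigma_{\mathrm{ess}}=\sigma\setminus\sigma_{\mathrm d}$, and $\Theta_{\mathrm N}:=\inf\sigma_{\mathrm{ess}}(\mathsf H_{\mathrm N,\phi})$. **Theorem.** Let $s:=\sqrt{9-2\pi}$,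 $$\mu_{1,2}:=\frac{s\pm1}{\sqrt{4-\pi}},\qquad \nu_{1,2}:=\frac{\sqrt{4-\pi}\,(3-\pi\pm s)}{2(1\pm s)},$$ where the upper sign corresponds to the index $1$ and the lower sign to the index $2$. If $\phi\in(0,\pi)$ is such that $$2\phi s\,\Theta_{\mathrm N}^2\left[2\phi s-\mu_1^2\mu_2^2\left\{\nu_1\tanh\left(\tfrac12\mu_1\phi\right)+\nu_2\tanh\left(\tfrac12\mu_2\phi\right)\right\}\right]^{-1}>1,$$ then $\sigma_{\mathrm d}(\mathsf H_{\mathrm N,\phi})\cap(-\infty,\Theta_{\mathrm N})\neq\varnothing$, i.e. $\mathsf H_{\mathrm N,\phi}$ has at least one bound state below $\Theta_{\mathrm N}$. -/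

import Mathlib

open MeasureTheory
open scoped ContDiff

namespace MagneticWedge

/-- The wedge of aperture `φ`: points with polar coordinates `r > 0` and `0 < θ < φ`.
The plane `ℝ²` is modelled on `ℝ × ℝ` with Lebesgue measure (its sup norm is never used
to measure lengths). -/
def wedge (φ : ℝ) : Set (ℝ × ℝ) :=
  {x | ∃ r θ : ℝ, 0 < r ∧ 0 < θ ∧ θ < φ ∧ x = (r * Real.cos θ, r * Real.sin θ)}

/-- The complex Hilbert space `L²(Ω)` with respect to Lebesgue measure. Its inner product
`inner ℂ f g` is conjugate-linear in the first slot. -/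
abbrev L2 (Ω : Set (ℝ × ℝ)) : Type :=
  Lp ℂ 2 (volume.restrict Ω)

/-- The Hilbert space `L²(Ω; ℂ²)`, as the Hilbert direct sum of two copies of `L²(Ω)`. -/
abbrev L2Vec (Ω : Set (ℝ × ℝ)) : Type :=
  WithLp 2 (L2 Ω × L2 Ω)

/-- The vector potential `A(x₁, x₂) = ½ (-x₂, x₁)` of the homogeneous magnetic field `B = 1`. -/
noncomputable def vectorPotential (x : ℝ × ℝ) : ℝ × ℝ :=
  (-x.2 / 2, x.1 / 2)

/-- Test functions on `Ω`: smooth complex functions with compact support inside `Ω`. -/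
structure IsTestFunction (Ω : Set (ℝ × ℝ)) (η : ℝ × ℝ → ℂ) : Prop where
  contDiff : ContDiff ℝ ∞ η
  hasCompactSupport : HasCompactSupport η
  tsupport_subset : tsupport η ⊆ Ω

/-- `g = i ∂ₑ u + a u` on `Ω` in the sense of distributions, where `∂ₑ` is the partial derivative
in the direction `e` and `a` is a real coefficient function. -/
def IsMagneticPartial (Ω : Set (ℝ × ℝ)) (e : ℝ × ℝ) (a : ℝ × ℝ → ℝ) (u g : L2 Ω) : Prop :=
  ∀ η : ℝ × ℝ → ℂ, IsTestFunction Ω η →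
    ∫ x in Ω, g x * η x = ∫ x in Ω, u x * (-Complex.I * fderiv ℝ η x e + (a x : ℂ) * η x)

section Integrability

variable {Ω : Set (ℝ × ℝ)}

theorem integrable_mul_of_continuous (u : L2 Ω) {η : ℝ × ℝ → ℂ} (hc : Continuous η)
    (hs : HasCompactSupport η) : Integrable (fun x => u x * η x) (volume.restrict Ω) :=
  (Lp.memLp u).integrable_mul (hc.memLp_of_hasCompactSupport (p := 2) hs)

theorem IsTestFunction.continuous_fderiv {η : ℝ × ℝ → ℂ} (hη : IsTestFunction Ω η) (e : ℝ × ℝ) :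
    Continuous (fun x => fderiv ℝ η x e) :=
  (hη.contDiff.continuous_fderiv (by simp)).clm_apply continuous_const

theorem IsTestFunction.integrable_mul (u : L2 Ω) {η : ℝ × ℝ → ℂ} (hη : IsTestFunction Ω η) :
    Integrable (fun x => u x * η x) (volume.restrict Ω) :=
  integrable_mul_of_continuous u hη.contDiff.continuous hη.hasCompactSupport

theorem IsTestFunction.integrable_mul_adjoint (u : L2 Ω) {η : ℝ × ℝ → ℂ}
    (hη : IsTestFunction Ω η) (e : ℝ × ℝ) {a : ℝ × ℝ → ℝ} (ha : Continuous a) :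
    Integrable (fun x => u x * (-Complex.I * fderiv ℝ η x e + (a x : ℂ) * η x))
      (volume.restrict Ω) := by
  refine integrable_mul_of_continuous u ?_ ?_
  · exact (continuous_const.mul (hη.continuous_fderiv e)).add
      ((Complex.continuous_ofReal.comp ha).mul hη.contDiff.continuous)
  · exact ((hη.hasCompactSupport.fderiv_apply ℝ e).mul_left).add
      (hη.hasCompactSupport.mul_left)

theorem IsMagneticPartial.zero (e : ℝ × ℝ) (a : ℝ × ℝ → ℝ) :
    IsMagneticPartial Ω e a 0 0 := by
  intro η _
  have h : ∀ᵐ x ∂(volume.restrict Ω), (0 : L2 Ω) x = 0 := Lp.coeFn_zero _ _ _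
  rw [integral_eq_zero_of_ae (h.mono fun x hx => by rw [hx, zero_mul, Pi.zero_apply]),
    integral_eq_zero_of_ae (h.mono fun x hx => by rw [hx, zero_mul, Pi.zero_apply])]

theorem IsMagneticPartial.add {e : ℝ × ℝ} {a : ℝ × ℝ → ℝ} (ha : Continuous a) {u g v h : L2 Ω}
    (hu : IsMagneticPartial Ω e a u g) (hv : IsMagneticPartial Ω e a v h) :
    IsMagneticPartial Ω e a (u + v) (g + h) := by
  intro η hη
  rw [integral_congr_ae (g := fun x => g x * η x + h x * η x)
      ((Lp.coeFn_add g h).mono fun x hx => by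
        simp only [hx, Pi.add_apply, add_mul]),
    integral_congr_ae (f := fun x => (u + v : L2 Ω) x * _)
      (g := fun x => u x * (-Complex.I * fderiv ℝ η x e + (a x : ℂ) * η x)
        + v x * (-Complex.I * fderiv ℝ η x e + (a x : ℂ) * η x))
      ((Lp.coeFn_add u v).mono fun x hx => by
        simp only [hx, Pi.add_apply, add_mul]),
    integral_add (hη.integrable_mul g) (hη.integrable_mul h),
    integral_add (hη.integrable_mul_adjoint u e ha) (hη.integrable_mul_adjoint v e ha),
    hu η hη, hv η hη]

theorem IsMagneticPartial.smul {e : ℝ × ℝ} {a : ℝ × ℝ → ℝ} (c : ℂ) {u g : L2 Ω}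
    (hu : IsMagneticPartial Ω e a u g) : IsMagneticPartial Ω e a (c • u) (c • g) := by
  intro η hη
  rw [integral_congr_ae (g := fun x => c * (g x * η x))
      ((Lp.coeFn_smul c g).mono fun x hx => by
        simp only [hx, Pi.smul_apply, smul_eq_mul, mul_assoc]),
    integral_congr_ae (f := fun x => (c • u : L2 Ω) x * _)
      (g := fun x => c * (u x * (-Complex.I * fderiv ℝ η x e + (a x : ℂ) * η x)))
      ((Lp.coeFn_smul c u).mono fun x hx => by
        simp only [hx, Pi.smul_apply, smul_eq_mul, mul_assoc]),
    integral_const_mul, integral_const_mul, hu η hη]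

end Integrability

theorem continuous_vectorPotential : Continuous vectorPotential := by
  unfold vectorPotential; fun_prop

/-- The graph of the distributional magnetic gradient `∇_A u = i ∇u + A u` on `L²(Ω)`:
pairs `(u, g)` with `u ∈ L²(Ω)`, `g ∈ L²(Ω; ℂ²)` and `g = i ∇u + A u` in the sense of
distributions. -/
def magneticGradientGraph (Ω : Set (ℝ × ℝ)) : Submodule ℂ (L2 Ω × L2Vec Ω) where
  carrier := {p |
    IsMagneticPartial Ω (1, 0) (fun x => (vectorPotential x).1) p.1 p.2.fst ∧
    IsMagneticPartial Ω (0, 1) (fun x => (vectorPotential x).2) p.1 p.2.snd}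
  zero_mem' := ⟨IsMagneticPartial.zero _ _, IsMagneticPartial.zero _ _⟩
  add_mem' := fun hp hq =>
    ⟨hp.1.add (continuous_fst.comp continuous_vectorPotential) hq.1,
      hp.2.add (continuous_snd.comp continuous_vectorPotential) hq.2⟩
  smul_mem' := fun c _ hp => ⟨hp.1.smul c, hp.2.smul c⟩

/-- The magnetic gradient `∇_A`, as an unbounded operator from `L²(Ω)` to `L²(Ω; ℂ²)`.
Its domain is the magnetic Sobolev space `H¹_A(Ω) = {u ∈ L²(Ω) : ∇_A u ∈ L²(Ω; ℂ²)}`. -/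
noncomputable def magneticGradient (Ω : Set (ℝ × ℝ)) : L2 Ω →ₗ.[ℂ] L2Vec Ω :=
  (magneticGradientGraph Ω).toLinearPMap

/-- The magnetic Sobolev space `H¹_A(Ω)`. -/
noncomputable abbrev magneticSobolev (Ω : Set (ℝ × ℝ)) : Submodule ℂ (L2 Ω) :=
  (magneticGradient Ω).domain

/-- The sesquilinear form `h[u, v] = ⟨∇_A u, ∇_A v⟩` on `H¹_A(Ω)` whose quadratic form is the
Neumann form `h[u] = ‖∇_A u‖²`. -/
noncomputable def neumannForm (Ω : Set (ℝ × ℝ)) (u v : magneticSobolev Ω) : ℂ :=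
  inner ℂ (magneticGradient Ω u) (magneticGradient Ω v)

/-- The graph of the operator associated with the Neumann form by the first representation
theorem: pairs `(u, w)` with `u ∈ H¹_A(Ω)`, `w ∈ L²(Ω)` and `h[v, u] = ⟨v, w⟩` for all
`v ∈ H¹_A(Ω)`. -/
def neumannGraph (Ω : Set (ℝ × ℝ)) : Submodule ℂ (L2 Ω × L2 Ω) where
  carrier := {p | ∃ u : magneticSobolev Ω, (u : L2 Ω) = p.1 ∧
    ∀ v : magneticSobolev Ω, neumannForm Ω v u = inner ℂ (v : L2 Ω) p.2}
  zero_mem' := ⟨0, rfl, fun v => by simp [neumannForm]⟩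
  add_mem' := by
    rintro p q ⟨u, hu, hu'⟩ ⟨v, hv, hv'⟩
    refine ⟨u + v, by simp [hu, hv], fun w => ?_⟩
    have h1 := hu' w
    have h2 := hv' w
    simp only [neumannForm] at h1 h2 ⊢
    rw [LinearPMap.map_add, inner_add_right, h1, h2, Prod.snd_add, inner_add_right]
  smul_mem' := by
    rintro c p ⟨u, hu, hu'⟩
    refine ⟨c • u, by simp [hu], fun w => ?_⟩
    have h1 := hu' w
    simp only [neumannForm] at h1 ⊢
    rw [LinearPMap.map_smul, inner_smul_right, h1, Prod.smul_snd, inner_smul_right]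

/-- The magnetic Neumann Laplacian on `Ω`: the (self-adjoint) operator in `L²(Ω)` associated with
the form `u ↦ ‖∇_A u‖²` on `H¹_A(Ω)`. -/
noncomputable def magneticNeumannLaplacian (Ω : Set (ℝ × ℝ)) : L2 Ω →ₗ.[ℂ] L2 Ω :=
  (neumannGraph Ω).toLinearPMap

section Spectrum

variable {H : Type*} [NormedAddCommGroup H] [InnerProductSpace ℂ H]

/-- The resolvent set of an unbounded operator `T`: those `z` for which `T - z` is a bijection from
the domain of `T` onto `H` with a bounded everywhere defined inverse `R`. -/
def resolventSet (T : H →ₗ.[ℂ] H) : Set ℂ :=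
  {z | ∃ R : H →L[ℂ] H,
    (∀ f : H, ∃ hf : R f ∈ T.domain, T ⟨R f, hf⟩ - z • R f = f) ∧
    ∀ u : T.domain, R (T u - z • (u : H)) = u}

/-- The spectrum of an unbounded operator. -/
def spectrum (T : H →ₗ.[ℂ] H) : Set ℂ :=
  (resolventSet T)ᶜ

/-- The eigenspace `ker (T - z)`, as a subspace of the domain of `T`. -/
def eigenspace (T : H →ₗ.[ℂ] H) (z : ℂ) : Submodule ℂ T.domain :=
  LinearMap.ker (T.toFun - z • T.domain.subtype)

/-- The discrete spectrum: eigenvalues of finite multiplicity that are isolated points of the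
spectrum. -/
def discreteSpectrum (T : H →ₗ.[ℂ] H) : Set ℂ :=
  {z | eigenspace T z ≠ ⊥ ∧ FiniteDimensional ℂ (eigenspace T z) ∧
    ∃ ε > 0, ∀ w ∈ spectrum T, dist w z < ε → w = z}

/-- The essential spectrum (of a self-adjoint operator): the complement of the discrete spectrum
in the spectrum. -/
def essentialSpectrum (T : H →ₗ.[ℂ] H) : Set ℂ :=
  spectrum T \ discreteSpectrum T

end Spectrum

/-- `Θ_N`: the infimum of the essential spectrum of the magnetic Neumann Laplacian on the wedge of
aperture `φ`. (The spectrum of a self-adjoint operator is real.) -/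
noncomputable def thetaN (φ : ℝ) : ℝ :=
  sInf {t : ℝ | (t : ℂ) ∈ essentialSpectrum (magneticNeumannLaplacian (wedge φ))}

/-! The two relations above are graphs of operators when `Ω` is open, and wedges are open. -/

section WellDefined

variable {Ω : Set (ℝ × ℝ)}

theorem isOpen_wedge {φ : ℝ} (hφ : φ ≤ Real.pi) : IsOpen (wedge φ) := by
  have h : wedge φ = polarCoord.symm '' (Set.Ioi 0 ×ˢ Set.Ioo 0 φ) := by
    ext x
    simp only [wedge, Set.mem_ofPred_eq, Set.mem_image, Set.mem_prod, Set.mem_Ioi, Set.mem_Ioo,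
      Prod.exists, polarCoord_symm_apply]
    constructor
    · rintro ⟨r, θ, hr, h0, h1, rfl⟩
      exact ⟨r, θ, ⟨hr, h0, h1⟩, rfl⟩
    · rintro ⟨r, θ, ⟨hr, h0, h1⟩, rfl⟩
      exact ⟨r, θ, hr, h0, h1, rfl⟩
  rw [h]
  refine polarCoord.symm.isOpen_image_of_subset_source (isOpen_Ioi.prod isOpen_Ioo) ?_
  rintro ⟨r, θ⟩ ⟨hr, h0, h1⟩
  simp only [OpenPartialHomeomorph.symm_source, polarCoord_target]
  exact ⟨hr, by linarith [Real.pi_pos, Set.mem_Ioo.1 ⟨h0, h1⟩ |>.1], lt_of_lt_of_le h1 hφ⟩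

theorem eq_zero_of_forall_test (hΩ : IsOpen Ω) (g : L2 Ω)
    (h : ∀ η : ℝ × ℝ → ℂ, IsTestFunction Ω η → ∫ x in Ω, g x * η x = 0) : g = 0 := by
  have hloc : LocallyIntegrable (fun x => g x) (volume.restrict Ω) :=
    (Lp.memLp g).locallyIntegrable (by norm_num)
  have key : ∀ᵐ x ∂(volume.restrict Ω), x ∈ Ω → g x = 0 := by
    refine hΩ.ae_eq_zero_of_integral_contDiff_smul_eq_zero (hloc.locallyIntegrableOn _) ?_
    intro η h1 h2 h3
    have hsub : Function.support (fun x => (η x : ℂ)) = Function.support η := by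
      ext x; simp
    have ht : tsupport (fun x => (η x : ℂ)) = tsupport η := by
      rw [tsupport, tsupport, hsub]
    have := h (fun x => (η x : ℂ))
      ⟨Complex.ofRealCLM.contDiff.comp h1, by rw [HasCompactSupport, ht]; exact h2, by rwa [ht]⟩
    rw [← this]
    refine integral_congr_ae (Filter.Eventually.of_forall fun x => ?_)
    simp [mul_comm]
  refine (Lp.eq_zero_iff_ae_eq_zero).2 ?_
  filter_upwards [key, ae_restrict_mem hΩ.measurableSet] with x hx hxm using hx hxm

theorem magneticGradientGraph_functional (hΩ : IsOpen Ω) (p : L2 Ω × L2Vec Ω)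
    (hp : p ∈ magneticGradientGraph Ω) (hp0 : p.1 = 0) : p.2 = 0 := by
  have aux : ∀ (e : ℝ × ℝ) (a : ℝ × ℝ → ℝ) (g : L2 Ω), IsMagneticPartial Ω e a 0 g → g = 0 := by
    intro e a g hg
    refine eq_zero_of_forall_test hΩ g fun η hη => ?_
    have h0 : ∀ᵐ x ∂(volume.restrict Ω), (0 : L2 Ω) x = 0 := Lp.coeFn_zero _ _ _
    rw [hg η hη]
    exact integral_eq_zero_of_ae (h0.mono fun x hx => by
      simp only [hx, zero_mul, Pi.zero_apply])
  obtain ⟨h1, h2⟩ := hp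
  rw [hp0] at h1 h2
  have e1 := aux _ _ _ h1
  have e2 := aux _ _ _ h2
  exact WithLp.ofLp_injective 2 (Prod.ext e1 e2)

theorem magneticGradient_graph (hΩ : IsOpen Ω) :
    (magneticGradient Ω).graph = magneticGradientGraph Ω :=
  Submodule.toLinearPMap_graph_eq _ (magneticGradientGraph_functional hΩ)

theorem IsTestFunction.memLp {η : ℝ × ℝ → ℂ} (hη : IsTestFunction Ω η) :
    MemLp η 2 (volume.restrict Ω) :=
  hη.contDiff.continuous.memLp_of_hasCompactSupport hη.hasCompactSupport

theorem IsTestFunction.exists_magneticPartial {ψ : ℝ × ℝ → ℂ} (hψ : IsTestFunction Ω ψ)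
    (e : ℝ × ℝ) {a : ℝ × ℝ → ℝ} (ha : Continuous a) :
    ∃ g : L2 Ω, IsMagneticPartial Ω e a hψ.memLp.toLp g := by
  have hac : Continuous (fun x => (a x : ℂ)) := Complex.continuous_ofReal.comp ha
  have hc : Continuous (fun x => Complex.I * fderiv ℝ ψ x e + (a x : ℂ) * ψ x) :=
    (continuous_const.mul (hψ.continuous_fderiv e)).add (hac.mul hψ.contDiff.continuous)
  have hs : HasCompactSupport (fun x => Complex.I * fderiv ℝ ψ x e + (a x : ℂ) * ψ x) :=
    ((hψ.hasCompactSupport.fderiv_apply ℝ e).mul_left).add hψ.hasCompactSupport.mul_left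
  refine ⟨(hc.memLp_of_hasCompactSupport (p := 2) hs).toLp, fun η hη => ?_⟩
  have hψc := hψ.contDiff.continuous
  have hηc := hη.contDiff.continuous
  rw [integral_congr_ae (g := fun x => (Complex.I * fderiv ℝ ψ x e + (a x : ℂ) * ψ x) * η x)
      ((MemLp.coeFn_toLp (hc.memLp_of_hasCompactSupport (p := 2) hs)).mono
        fun x hx => by simp only [hx]),
    integral_congr_ae (f := fun x => (hψ.memLp.toLp : L2 Ω) x * _)
      (g := fun x => ψ x * (-Complex.I * fderiv ℝ η x e + (a x : ℂ) * η x))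
      ((MemLp.coeFn_toLp hψ.memLp).mono fun x hx => by simp only [hx])]
  have z : ∀ x, x ∉ Ω → ψ x = 0 ∧ fderiv ℝ ψ x e = 0 := by
    intro x hx
    have hx' : x ∉ tsupport ψ := fun h => hx (hψ.tsupport_subset h)
    refine ⟨image_eq_zero_of_notMem_tsupport hx', ?_⟩
    rw [image_eq_zero_of_notMem_tsupport fun h => hx' (tsupport_fderiv_subset ℝ h)]
    simp
  rw [setIntegral_eq_integral_of_forall_compl_eq_zero fun x hx => by simp [z x hx],
    setIntegral_eq_integral_of_forall_compl_eq_zero fun x hx => by simp [z x hx]]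
  have i1 : Integrable (fun x => fderiv ℝ ψ x e * η x) (volume : Measure (ℝ × ℝ)) :=
    ((hψ.continuous_fderiv e).mul hηc).integrable_of_hasCompactSupport
      hη.hasCompactSupport.mul_left
  have i2 : Integrable (fun x => ψ x * fderiv ℝ η x e) (volume : Measure (ℝ × ℝ)) :=
    (hψc.mul (hη.continuous_fderiv e)).integrable_of_hasCompactSupport
      hψ.hasCompactSupport.mul_right
  have i3 : Integrable (fun x => ψ x * η x) (volume : Measure (ℝ × ℝ)) :=
    (hψc.mul hηc).integrable_of_hasCompactSupport hψ.hasCompactSupport.mul_right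
  have i4 : Integrable (fun x => (a x : ℂ) * (ψ x * η x)) (volume : Measure (ℝ × ℝ)) :=
    (hac.mul (hψc.mul hηc)).integrable_of_hasCompactSupport
      (hψ.hasCompactSupport.mul_right.mul_left)
  have ibp := integral_mul_fderiv_eq_neg_fderiv_mul_of_integrable i1 i2 i3
    (fun x _ => hψ.contDiff.differentiable (by simp) x)
    (fun x _ => hη.contDiff.differentiable (by simp) x)
  have e1 : (fun x => (Complex.I * fderiv ℝ ψ x e + (a x : ℂ) * ψ x) * η x)
      = fun x => Complex.I * (fderiv ℝ ψ x e * η x) + (a x : ℂ) * (ψ x * η x) := by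
    ext x; ring
  have e2 : (fun x => ψ x * (-Complex.I * fderiv ℝ η x e + (a x : ℂ) * η x))
      = fun x => -Complex.I * (ψ x * fderiv ℝ η x e) + (a x : ℂ) * (ψ x * η x) := by
    ext x; ring
  rw [e1, e2, integral_add (i1.const_mul _) i4, integral_add (i2.const_mul _) i4,
    integral_const_mul, integral_const_mul, ibp]
  ring

theorem IsTestFunction.mem_magneticSobolev {ψ : ℝ × ℝ → ℂ} (hψ : IsTestFunction Ω ψ) :
    (hψ.memLp.toLp : L2 Ω) ∈ magneticSobolev Ω := by
  obtain ⟨g₁, h₁⟩ := hψ.exists_magneticPartial (1, 0)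
    (continuous_fst.comp continuous_vectorPotential)
  obtain ⟨g₂, h₂⟩ := hψ.exists_magneticPartial (0, 1)
    (continuous_snd.comp continuous_vectorPotential)
  exact ⟨(hψ.memLp.toLp, WithLp.toLp 2 (g₁, g₂)), ⟨h₁, h₂⟩, rfl⟩

theorem neumannGraph_functional (hΩ : IsOpen Ω) (p : L2 Ω × L2 Ω)
    (hp : p ∈ neumannGraph Ω) (hp0 : p.1 = 0) : p.2 = 0 := by
  obtain ⟨u, hu, hw⟩ := hp
  have hu0 : u = 0 := Subtype.ext (hu.trans hp0)
  refine eq_zero_of_forall_test hΩ _ fun η hη => ?_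
  have hη' : IsTestFunction Ω (fun x => (starRingEnd ℂ) (η x)) := by
    have hsub : Function.support (fun x => (starRingEnd ℂ) (η x)) = Function.support η := by
      ext x; simp
    have ht : tsupport (fun x => (starRingEnd ℂ) (η x)) = tsupport η := by
      rw [tsupport, tsupport, hsub]
    exact ⟨Complex.conjCLE.contDiff.comp hη.contDiff, by
      rw [HasCompactSupport, ht]; exact hη.hasCompactSupport, by
      rw [ht]; exact hη.tsupport_subset⟩
  have h := hw ⟨_, hη'.mem_magneticSobolev⟩
  rw [hu0, neumannForm, LinearPMap.map_zero, inner_zero_right, L2.inner_def] at h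
  rw [h]
  refine integral_congr_ae ?_
  filter_upwards [hη'.memLp.coeFn_toLp] with x hx
  simp [hx]

theorem magneticNeumannLaplacian_graph (hΩ : IsOpen Ω) :
    (magneticNeumannLaplacian Ω).graph = neumannGraph Ω :=
  Submodule.toLinearPMap_graph_eq _ (neumannGraph_functional hΩ)

end WellDefined

end MagneticWedge

/-!
The theorem is an application of the min-max principle to an explicit trial function.

*Spectral part.* Let `V` be the form domain `H¹_A`, a Hilbert space for the graph norm of `∇_A`
because weak derivatives pass to `L²` limits, and let `J : V → L²` be the embedding. By the
definition of the adjoint, `R = J J*` is the resolvent of the Neumann Laplacian at `-1`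
(`isResolventAtNegOne_formResolvent`). Since `1 / (z + 1)` is in the spectrum of `R` precisely
when `z` is in that of the Laplacian, the Laplacian has no negative spectrum; and if it has no
spectrum below `Θ`, then `‖J‖² = ‖R‖ ≤ 1 / (Θ + 1)`, which says `‖∇_A u‖² ≥ Θ ‖u‖²` for all
`u ∈ V` (`mul_norm_sq_le_of_forall_mem_resolventSet`). A function whose energy quotient is below
`Θ_N` therefore forces spectrum below the essential spectrum (`exists_mem_discreteSpectrum`).

*Trial function.* For `u = exp (-k² r² / 2 + i (r² c(θ) + r B(θ) / k))` the radial integrals are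
Gaussian moments, and the energy quotient is `k² + Q / k²` with `Q` the mean over `(0, φ)` of a
quadratic expression in `c`, `c'`, `B`, `B'` (`exists_mem_graphSpace_of_angularDensity`). Choosing
`k⁴ = Q` gives `2 √Q`. The Euler-Lagrange equations of `Q` are linear with constant coefficients;
the solution with natural boundary conditions consists of two hyperbolic sines centred at `φ / 2`
with exponents `μ₁`, `μ₂`, and its energy is a boundary term
(`exists_integral_angularDensity_eq`). With these `B` and `c` the hypothesis of the theorem reads
`4 Q < Θ_N²`.
-/

namespace MagneticWedge

/-! ### Operators with a bounded resolvent at `-1` -/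

section Resolvent

variable {H : Type*} [NormedAddCommGroup H] [InnerProductSpace ℂ H]

/-- `R = (T + 1)⁻¹`, expressed through the graph of `T`: `T u = w` if and only if
`R (w + u) = u`. -/
def IsResolventAtNegOne (T : H →ₗ.[ℂ] H) (R : H →L[ℂ] H) : Prop :=
  ∀ u w : H, (u, w) ∈ T.graph ↔ R (w + u) = u

namespace IsResolventAtNegOne

variable {T : H →ₗ.[ℂ] H} {R : H →L[ℂ] H}

theorem apply_add (hR : IsResolventAtNegOne T R) (u : T.domain) : R (T u + u) = u :=
  (hR _ _).1 (T.mem_graph u)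

theorem exists_apply_eq (hR : IsResolventAtNegOne T R) (f : H) :
    ∃ hf : R f ∈ T.domain, T ⟨R f, hf⟩ = f - R f := by
  have h : (R f, f - R f) ∈ T.graph := (hR _ _).2 (by rw [sub_add_cancel])
  obtain ⟨y, hy, h⟩ := T.mem_graph_iff.1 h
  simp only at hy h
  refine ⟨hy ▸ y.2, ?_⟩
  rw [← h]
  congr 1
  exact Subtype.ext hy.symm

theorem negOne_mem_resolventSet (hR : IsResolventAtNegOne T R) : (-1 : ℂ) ∈ resolventSet T := by
  refine ⟨R, fun f => ?_, fun u => ?_⟩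
  · obtain ⟨hf, h⟩ := hR.exists_apply_eq f
    exact ⟨hf, by rw [h]; module⟩
  · conv_rhs => rw [← hR.apply_add u]
    congr 1
    module

/-- If `S = (T - z)⁻¹` exists, then `(z + 1) (1 + (z + 1) S)` inverts `(z + 1)⁻¹ - R`. -/
theorem notMem_spectrum_of_mem_resolventSet (hR : IsResolventAtNegOne T R) {z : ℂ} (hz : z + 1 ≠ 0)
    (h : z ∈ resolventSet T) : (z + 1)⁻¹ ∉ _root_.spectrum ℂ R := by
  obtain ⟨S, hS₁, hS₂⟩ := h
  have hRS : ∀ f, R f + (z + 1) • R (S f) = S f := by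
    intro f
    obtain ⟨hf, h⟩ := hS₁ f
    have h2 := hR.apply_add ⟨S f, hf⟩
    rw [sub_eq_iff_eq_add.1 h] at h2
    simp only [map_add, map_smul] at h2
    linear_combination (norm := module) h2
  have hSR : ∀ f, R f + (z + 1) • S (R f) = S f := by
    intro f
    obtain ⟨hf, h⟩ := hR.exists_apply_eq f
    have h2 := hS₂ ⟨R f, hf⟩
    rw [h] at h2
    simp only [map_sub, map_smul] at h2
    linear_combination (norm := module) (-1 : ℂ) • h2
  rw [_root_.spectrum.notMem_iff, isUnit_iff_exists]
  refine ⟨(z + 1) • (1 + (z + 1) • S), ?_, ?_⟩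
  · ext f
    have h := hRS f
    simp only [mul_apply_eq_comp, sub_apply, map_add, map_smul, smul_apply, add_apply,
      Algebra.algebraMap_eq_smul_one, one_apply_eq_self]
    linear_combination (norm := (match_scalars <;> field_simp <;> ring)) (-(z + 1)) • h
  · ext f
    have h := hSR f
    simp only [mul_apply_eq_comp, sub_apply, map_sub, map_smul, smul_apply, add_apply,
      Algebra.algebraMap_eq_smul_one, one_apply_eq_self]
    linear_combination (norm := (match_scalars <;> field_simp <;> ring)) (-(z + 1)) • h

/-- If `S` inverts `(z + 1)⁻¹ - R`, then `(z + 1)⁻¹ S R` is the resolvent `(T - z)⁻¹`. -/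
theorem mem_resolventSet_of_notMem_spectrum (hR : IsResolventAtNegOne T R) {z : ℂ} (hz : z + 1 ≠ 0)
    (h : (z + 1)⁻¹ ∉ _root_.spectrum ℂ R) : z ∈ resolventSet T := by
  rw [_root_.spectrum.notMem_iff, isUnit_iff_exists] at h
  obtain ⟨S, h₁, h₂⟩ := h
  have hRS : ∀ f, (z + 1)⁻¹ • S f - R (S f) = f := fun f => by
    simpa [Algebra.algebraMap_eq_smul_one] using congr($h₁ f)
  have hSR : ∀ f, (z + 1)⁻¹ • S f - S (R f) = f := fun f => by
    simpa [Algebra.algebraMap_eq_smul_one] using congr($h₂ f)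
  have hcomm : ∀ f, S (R f) = R (S f) := fun f =>
    sub_right_injective ((hSR f).trans (hRS f).symm)
  refine ⟨(z + 1)⁻¹ • S * R, fun f => ?_, fun u => ?_⟩
  · have he : ((z + 1)⁻¹ • S * R) f = R ((z + 1)⁻¹ • S f) := by simp [hcomm]
    obtain ⟨hf, h⟩ := hR.exists_apply_eq ((z + 1)⁻¹ • S f)
    refine ⟨he ▸ hf, ?_⟩
    simp only [he, h]
    have h3 := hRS f
    rw [map_smul]
    linear_combination (norm := (match_scalars <;> field_simp <;> ring)) h3
  · have h1 := hR.apply_add u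
    have h2 := hSR u
    have h3 : R (T u - z • (u : H)) = u - (z + 1) • R u := by
      rw [map_add] at h1
      rw [map_sub, map_smul]
      linear_combination (norm := module) h1
    rw [mul_apply_eq_comp, smul_apply, h3, map_sub, map_smul]
    linear_combination (norm := (match_scalars <;> field_simp <;> ring)) h2

variable [CompleteSpace H]

/-- A positive contraction has no spectrum outside `[0, 1]`, hence `T` has none below `0`. -/
theorem ofReal_mem_resolventSet_of_neg (hR : IsResolventAtNegOne T R) (hpos : R.IsPositive)
    (hnorm : ‖R‖ ≤ 1) {t : ℝ} (ht : t < 0) : (t : ℂ) ∈ resolventSet T := by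
  rcases eq_or_ne t (-1) with rfl | ht1
  · simpa using hR.negOne_mem_resolventSet
  have ht1' : t + 1 ≠ 0 := fun h => ht1 (by linarith)
  refine hR.mem_resolventSet_of_notMem_spectrum (by exact_mod_cast ht1') fun hmem => ?_
  have hmem' : (algebraMap ℝ ℂ (t + 1)⁻¹) ∈ _root_.spectrum ℂ R := by simpa using hmem
  rw [_root_.spectrum.algebraMap_mem_iff] at hmem'
  have h0 : 0 ≤ (t + 1)⁻¹ :=
    spectrum_nonneg_of_nonneg ((ContinuousLinearMap.nonneg_iff_isPositive R).2 hpos) hmem'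
  have h1 : (t + 1)⁻¹ ≤ 1 := by
    have := _root_.spectrum.norm_le_norm_mul_of_mem hmem
    have h2 : ‖((t : ℂ) + 1)⁻¹‖ = |(t + 1)⁻¹| := by
      rw [← Real.norm_eq_abs, ← Complex.norm_real]; simp
    rw [h2] at this
    have h3 : ‖(1 : H →L[ℂ] H)‖ ≤ 1 := ContinuousLinearMap.norm_id_le
    calc (t + 1)⁻¹ ≤ |(t + 1)⁻¹| := le_abs_self _
      _ ≤ ‖R‖ * ‖(1 : H →L[ℂ] H)‖ := this
      _ ≤ 1 * 1 := by gcongr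
      _ = 1 := one_mul _
  have h2 : 0 < t + 1 := lt_of_le_of_ne (inv_nonneg.1 h0) (Ne.symm ht1')
  have := (inv_le_one₀ h2).1 h1
  linarith

/-- If `T` has no real spectrum below `m ≥ 0`, then the spectrum of `R = (T + 1)⁻¹` lies in
`[0, 1 / (m + 1)]`, which bounds the norm of the self-adjoint operator `R`. -/
theorem norm_le_of_forall_mem_resolventSet (hR : IsResolventAtNegOne T R) (hpos : R.IsPositive)
    {m : ℝ} (hm : 0 ≤ m) (h : ∀ t : ℝ, t < m → (t : ℂ) ∈ resolventSet T) : ‖R‖ ≤ (m + 1)⁻¹ := by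
  have hsa : IsSelfAdjoint R := hpos.isSelfAdjoint
  have hm1 : 0 < (m + 1)⁻¹ := by positivity
  have hsub : ∀ k ∈ _root_.spectrum ℂ R, ‖k‖ ≤ (m + 1)⁻¹ := by
    intro k hk
    obtain ⟨x, rfl⟩ : ∃ x : ℝ, k = x := ⟨k.re, hsa.mem_spectrum_eq_re hk⟩
    have hx : x ∈ _root_.spectrum ℝ R := (_root_.spectrum.algebraMap_mem_iff ℂ).1 hk
    have h0 : 0 ≤ x :=
      spectrum_nonneg_of_nonneg ((ContinuousLinearMap.nonneg_iff_isPositive R).2 hpos) hx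
    rw [Complex.norm_real, Real.norm_of_nonneg h0]
    by_contra! hlt
    have hx0 : 0 < x := hm1.trans hlt
    have hlt' : x⁻¹ < m + 1 := (inv_lt_comm₀ (by positivity) hx0).1 hlt
    -- `x > 1 / (m + 1)` corresponds to the spectral parameter `1 / x - 1 < m`.
    have h2 := hR.notMem_spectrum_of_mem_resolventSet (z := ((x⁻¹ - 1 : ℝ) : ℂ))
      (by push_cast; simpa using hx0.ne') (h _ (by linarith))
    refine h2 ?_
    push_cast
    simpa using hk
  have h2 : spectralRadius ℂ R ≤ ENNReal.ofReal (m + 1)⁻¹ :=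
    iSup₂_le fun k hk => by
      rw [← enorm_eq_nnnorm, ← ofReal_norm]
      exact ENNReal.ofReal_le_ofReal (hsub k hk)
  rwa [hsa.spectralRadius_eq_nnnorm, ← enorm_eq_nnnorm, ← ofReal_norm,
    ENNReal.ofReal_le_ofReal_iff hm1.le] at h2

end IsResolventAtNegOne
end Resolvent

/-! ### The operator of a closed form -/

section FormOperator

variable {H K : Type*} [NormedAddCommGroup H] [InnerProductSpace ℂ H]
  [NormedAddCommGroup K] [InnerProductSpace ℂ K]

/-- The embedding into `H` of the graph of an operator `G` from `H` to `K`. The graph with the norm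
of `H ⊕ K` is the domain of `G` with the norm `(‖u‖² + ‖G u‖²)^{1/2}`. -/
def graphEmbedding (Γ : Submodule ℂ (WithLp 2 (H × K))) : Γ →L[ℂ] H :=
  (WithLp.fstL 2 ℂ H K).comp Γ.subtypeL

theorem graphEmbedding_apply {Γ : Submodule ℂ (WithLp 2 (H × K))} (p : Γ) :
    graphEmbedding Γ p = (p : WithLp 2 (H × K)).fst := rfl

theorem norm_graphEmbedding_le (Γ : Submodule ℂ (WithLp 2 (H × K))) : ‖graphEmbedding Γ‖ ≤ 1 := by
  refine ContinuousLinearMap.opNorm_le_bound _ zero_le_one fun p => ?_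
  rw [one_mul, graphEmbedding_apply]
  exact WithLp.norm_fst_le _ _

variable [CompleteSpace H]

/-- With `J` the embedding of the form domain, `J J*` is the resolvent at `-1` of the operator
associated with the form `u ↦ ‖G u‖²`. -/
noncomputable def formResolvent (Γ : Submodule ℂ (WithLp 2 (H × K))) [CompleteSpace Γ] :
    H →L[ℂ] H :=
  graphEmbedding Γ ∘L (graphEmbedding Γ).adjoint

variable (Γ : Submodule ℂ (WithLp 2 (H × K))) [CompleteSpace Γ]

theorem isPositive_formResolvent : (formResolvent Γ).IsPositive :=
  ContinuousLinearMap.isPositive_self_comp_adjoint _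

theorem norm_formResolvent : ‖formResolvent Γ‖ = ‖graphEmbedding Γ‖ ^ 2 := by
  have h := ContinuousLinearMap.norm_adjoint_comp_self (graphEmbedding Γ).adjoint
  rw [ContinuousLinearMap.adjoint_adjoint, LinearIsometryEquiv.norm_map] at h
  rw [formResolvent, h, sq]

variable {Γ}

/-- The first representation theorem in resolvent form: by definition of the adjoint,
`J* f` is the element of the form domain that represents `⟨·, f⟩` in the graph inner product. -/
theorem isResolventAtNegOne_formResolvent {T : H →ₗ.[ℂ] H}
    (hT : ∀ u w : H, (u, w) ∈ T.graph ↔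
      ∃ p ∈ Γ, p.fst = u ∧ ∀ q ∈ Γ, inner ℂ q.snd p.snd = inner ℂ q.fst w) :
    IsResolventAtNegOne T (formResolvent Γ) := by
  intro u w
  rw [hT]
  constructor
  · rintro ⟨p, hp, rfl, hw⟩
    have h : (graphEmbedding Γ).adjoint (w + p.fst) = ⟨p, hp⟩ := by
      refine ext_inner_left ℂ fun q => ?_
      rw [ContinuousLinearMap.adjoint_inner_right, graphEmbedding_apply, Submodule.coe_inner,
        WithLp.prod_inner_apply, inner_add_right, ← hw q q.2, add_comm]
      rfl
    rw [formResolvent, ContinuousLinearMap.comp_apply, h]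
    rfl
  · intro h
    set p := (graphEmbedding Γ).adjoint (w + u) with hp
    have hu : (p : WithLp 2 (H × K)).fst = u := h
    refine ⟨p, p.2, h, fun q hq => ?_⟩
    have h3 := ContinuousLinearMap.adjoint_inner_right (graphEmbedding Γ) ⟨q, hq⟩ (w + u)
    rw [← hp, Submodule.coe_inner, WithLp.prod_inner_apply, graphEmbedding_apply,
      inner_add_right, ← hu] at h3
    exact add_left_cancel (h3.trans (add_comm _ _))

/-- The operator of a non-negative form has no spectrum below `0`. -/
theorem ofReal_mem_resolventSet_of_neg {T : H →ₗ.[ℂ] H}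
    (hT : IsResolventAtNegOne T (formResolvent Γ)) {t : ℝ} (ht : t < 0) :
    (t : ℂ) ∈ resolventSet T := by
  refine hT.ofReal_mem_resolventSet_of_neg (isPositive_formResolvent Γ) ?_ ht
  rw [norm_formResolvent]
  exact pow_le_one₀ (ContinuousLinearMap.opNorm_nonneg _) (norm_graphEmbedding_le Γ)

/-- If the operator of the form `‖G u‖²` has no real spectrum below `m`, then
`‖G u‖² ≥ m ‖u‖²`: indeed `‖J‖² = ‖J J*‖ ≤ 1 / (m + 1)`. -/
theorem mul_norm_sq_le_of_forall_mem_resolventSet {T : H →ₗ.[ℂ] H}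
    (hT : IsResolventAtNegOne T (formResolvent Γ)) {m : ℝ} (hm : 0 ≤ m)
    (h : ∀ t : ℝ, t < m → (t : ℂ) ∈ resolventSet T) {p : WithLp 2 (H × K)} (hp : p ∈ Γ) :
    m * ‖p.fst‖ ^ 2 ≤ ‖p.snd‖ ^ 2 := by
  have hle := hT.norm_le_of_forall_mem_resolventSet (isPositive_formResolvent Γ) hm h
  rw [norm_formResolvent] at hle
  have h1 := (graphEmbedding Γ).le_opNorm ⟨p, hp⟩
  have h2 := pow_le_pow_left₀ (norm_nonneg _) h1 2
  rw [mul_pow, Submodule.coe_norm, WithLp.prod_norm_sq_eq_of_L2, graphEmbedding_apply] at h2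
  have h3 := h2.trans (mul_le_mul_of_nonneg_right hle (by positivity))
  rw [inv_mul_eq_div, le_div_iff₀ (by positivity)] at h3
  linarith

end FormOperator

/-! ### The Neumann form as a Hilbert space -/

section FormDomain

variable {Ω : Set (ℝ × ℝ)}

theorem continuous_integral_mul {η : ℝ × ℝ → ℂ} (hc : Continuous η) (hs : HasCompactSupport η) :
    Continuous fun u : L2 Ω => ∫ x in Ω, u x * η x := by
  have hm : MemLp (fun x => (starRingEnd ℂ) (η x)) 2 (volume.restrict Ω) :=
    (Complex.continuous_conj.comp hc).memLp_of_hasCompactSupport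
      (hs.comp_left (g := starRingEnd ℂ) (map_zero _))
  have h : (fun u : L2 Ω => ∫ x in Ω, u x * η x) = fun u => inner ℂ (hm.toLp : L2 Ω) u := by
    ext u
    rw [L2.inner_def]
    refine integral_congr_ae ?_
    filter_upwards [hm.coeFn_toLp] with x hx
    simp [hx]
  rw [h]
  fun_prop

/-- Weak derivatives pass to `L²` limits, since both sides of the defining identity are continuous
in `L²` for a fixed test function. -/
theorem isClosed_isMagneticPartial (e : ℝ × ℝ) {a : ℝ × ℝ → ℝ} (ha : Continuous a) :
    IsClosed {p : L2 Ω × L2 Ω | IsMagneticPartial Ω e a p.1 p.2} := by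
  simp only [IsMagneticPartial, Set.ofPred_forall]
  refine isClosed_iInter fun η => isClosed_iInter fun hη => isClosed_eq ?_ ?_
  · exact (continuous_integral_mul hη.contDiff.continuous hη.hasCompactSupport).comp continuous_snd
  · refine (continuous_integral_mul ?_ ?_).comp continuous_fst
    · exact (continuous_const.mul (hη.continuous_fderiv e)).add
        ((Complex.continuous_ofReal.comp ha).mul hη.contDiff.continuous)
    · exact ((hη.hasCompactSupport.fderiv_apply ℝ e).mul_left).add
        (hη.hasCompactSupport.mul_left)

variable (Ω) in
/-- `H¹_A(Ω)` with the graph norm `(‖u‖² + ‖∇_A u‖²)^{1/2}`, realised as the graph of `∇_A`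
inside the Hilbert sum `L²(Ω) ⊕ L²(Ω; ℂ²)`. -/
noncomputable def graphSpace : Submodule ℂ (WithLp 2 (L2 Ω × L2Vec Ω)) :=
  (magneticGradientGraph Ω).comap (WithLp.linearEquiv 2 ℂ (L2 Ω × L2Vec Ω)).toLinearMap

theorem isClosed_graphSpace : IsClosed (graphSpace Ω : Set (WithLp 2 (L2 Ω × L2Vec Ω))) := by
  have h₁ := isClosed_isMagneticPartial (Ω := Ω) (1, 0)
    (continuous_fst.comp continuous_vectorPotential)
  have h₂ := isClosed_isMagneticPartial (Ω := Ω) (0, 1)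
    (continuous_snd.comp continuous_vectorPotential)
  exact (h₁.preimage (f := fun p : WithLp 2 (L2 Ω × L2Vec Ω) => (p.fst, p.snd.fst))
    (by fun_prop)).inter (h₂.preimage
      (f := fun p : WithLp 2 (L2 Ω × L2Vec Ω) => (p.fst, p.snd.snd)) (by fun_prop))

instance : CompleteSpace (graphSpace Ω) :=
  isClosed_graphSpace.completeSpace_coe

theorem mem_graphSpace_iff (hΩ : IsOpen Ω) {p : WithLp 2 (L2 Ω × L2Vec Ω)} :
    p ∈ graphSpace Ω ↔ ∃ u : magneticSobolev Ω, (u : L2 Ω) = p.fst ∧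
      magneticGradient Ω u = p.snd := by
  have h : p ∈ graphSpace Ω ↔ (p.fst, p.snd) ∈ (magneticGradient Ω).graph := by
    rw [magneticGradient_graph hΩ]; rfl
  rw [h, LinearPMap.mem_graph_iff]

/-- The Neumann Laplacian is the operator of the form given by the graph of `∇_A`. -/
theorem isResolventAtNegOne_magneticNeumannLaplacian (hΩ : IsOpen Ω) :
    IsResolventAtNegOne (magneticNeumannLaplacian Ω) (formResolvent (graphSpace Ω)) := by
  refine isResolventAtNegOne_formResolvent fun u w => ?_
  rw [magneticNeumannLaplacian_graph hΩ]
  constructor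
  · rintro ⟨u', rfl, hw⟩
    refine ⟨WithLp.toLp 2 ((u' : L2 Ω), magneticGradient Ω u'),
      (mem_graphSpace_iff hΩ).2 ⟨u', rfl, rfl⟩, rfl, fun q hq => ?_⟩
    obtain ⟨v, hv₁, hv₂⟩ := (mem_graphSpace_iff hΩ).1 hq
    rw [← hv₁, ← hv₂]
    exact hw v
  · rintro ⟨p, hp, rfl, hw⟩
    obtain ⟨u', h₁, h₂⟩ := (mem_graphSpace_iff hΩ).1 hp
    refine ⟨u', h₁, fun v => ?_⟩
    rw [neumannForm, h₂]
    exact hw (WithLp.toLp 2 ((v : L2 Ω), magneticGradient Ω v))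
      ((mem_graphSpace_iff hΩ).2 ⟨v, rfl, rfl⟩)

end FormDomain

/-! ### Reduction to a trial function -/

/-- If the spectrum below `Θ_N` were empty, the form would be bounded below by `Θ_N`. Points of
the spectrum below the essential spectrum are discrete. The spectrum is non-negative, so that
`0 ≤ Θ_N` may be used in estimating the energy of the trial function. -/
theorem exists_mem_discreteSpectrum {φ : ℝ} (hφ : φ ≤ Real.pi)
    {p : WithLp 2 (L2 (wedge φ) × L2Vec (wedge φ))} (hp : p ∈ graphSpace (wedge φ))
    (hlt : 0 ≤ thetaN φ → ‖p.snd‖ ^ 2 < thetaN φ * ‖p.fst‖ ^ 2) :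
    ∃ t : ℝ, t < thetaN φ ∧
      (t : ℂ) ∈ discreteSpectrum (magneticNeumannLaplacian (wedge φ)) := by
  have hR := isResolventAtNegOne_magneticNeumannLaplacian (isOpen_wedge hφ)
  have hnonneg : ∀ t ∈ {t : ℝ | (t : ℂ) ∈ essentialSpectrum (magneticNeumannLaplacian (wedge φ))},
      0 ≤ t := by
    intro t ht
    by_contra! h
    exact ht.1 (ofReal_mem_resolventSet_of_neg hR h)
  -- This also covers an empty essential spectrum, where the infimum takes the value `0`.
  have hΘ : 0 ≤ thetaN φ := Real.sInf_nonneg hnonneg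
  by_contra! hcon
  refine (hlt hΘ).not_ge (mul_norm_sq_le_of_forall_mem_resolventSet hR hΘ (fun t ht => ?_) hp)
  by_contra hmem
  -- A non-discrete point of the spectrum is essential, hence not below the infimum.
  exact ht.not_ge (csInf_le ⟨0, hnonneg⟩ ⟨hmem, hcon t ht⟩)

/-! ### Classical derivatives are distributional derivatives -/

section Classical

variable {Ω : Set (ℝ × ℝ)}

/-- Integration by parts against test functions. Nothing is assumed near the boundary of `Ω`, where
test functions vanish. -/
theorem isMagneticPartial_of_contDiffOn (hΩ : IsOpen Ω) {ψ : ℝ × ℝ → ℂ} (hψ : ContDiffOn ℝ 1 ψ Ω)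
    (e : ℝ × ℝ) {a : ℝ × ℝ → ℝ} (ha : Continuous a) (hm : MemLp ψ 2 (volume.restrict Ω))
    (hg : MemLp (fun x => Complex.I * fderiv ℝ ψ x e + (a x : ℂ) * ψ x) 2 (volume.restrict Ω)) :
    IsMagneticPartial Ω e a hm.toLp hg.toLp := by
  intro η hη
  have hηc := hη.contDiff.continuous
  have hψ' : ContinuousOn (fun x => fderiv ℝ ψ x e) Ω :=
    (hψ.continuousOn_fderiv_of_isOpen hΩ le_rfl).clm_apply continuousOn_const
  have ht : ∀ x ∉ Ω, x ∉ tsupport η := fun x hx h => hx (hη.tsupport_subset h)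
  have z : ∀ x, x ∉ Ω → η x = 0 ∧ fderiv ℝ η x e = 0 := fun x hx =>
    ⟨image_eq_zero_of_notMem_tsupport (ht x hx), by
      rw [image_eq_zero_of_notMem_tsupport fun h => ht x hx (tsupport_fderiv_subset ℝ h)]; simp⟩
  -- A product with a factor supported in `tsupport η` is continuous on the whole plane.
  have glue : ∀ f g : ℝ × ℝ → ℂ, ContinuousOn f Ω → Continuous g → tsupport g ⊆ tsupport η →
      Integrable (fun x => f x * g x) := by
    intro f g hf hg hsub
    have hsub' : tsupport (fun x => f x * g x) ⊆ tsupport g := tsupport_mul_subset_right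
    refine Continuous.integrable_of_hasCompactSupport ?_
      (hη.hasCompactSupport.of_isClosed_subset (isClosed_tsupport _) (hsub'.trans hsub))
    refine continuous_of_tsupport fun x hx => ?_
    have hxΩ : Ω ∈ nhds x := hΩ.mem_nhds (hη.tsupport_subset (hsub (hsub' hx)))
    exact (hf.continuousAt hxΩ).mul hg.continuousAt
  have hsub : tsupport (fun x => fderiv ℝ η x e) ⊆ tsupport η :=
    (closure_mono fun x hx => by
      simp only [Function.mem_support] at hx ⊢
      exact fun h => hx (by rw [h]; simp)).trans (tsupport_fderiv_subset ℝ)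
  have i1 := glue _ _ hψ' hηc subset_rfl
  have i2 := glue _ _ hψ.continuousOn (hη.continuous_fderiv e) hsub
  have i3 := glue _ _ hψ.continuousOn hηc subset_rfl
  have i4 := glue (fun x => (a x : ℂ) * ψ x) _
    ((Complex.continuous_ofReal.comp ha).continuousOn.mul hψ.continuousOn) hηc subset_rfl
  have ibp := integral_mul_fderiv_eq_neg_fderiv_mul_of_integrable i1 i2 i3
    (fun x hx => (hψ.differentiableOn one_ne_zero).differentiableAt
      (hΩ.mem_nhds (hη.tsupport_subset hx)))
    (fun x _ => hη.contDiff.differentiable (by simp) x)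
  rw [integral_congr_ae (g := fun x => (Complex.I * fderiv ℝ ψ x e + (a x : ℂ) * ψ x) * η x)
      (hg.coeFn_toLp.mono fun x hx => by simp only [hx]),
    integral_congr_ae (f := fun x => (hm.toLp : L2 Ω) x * _)
      (g := fun x => ψ x * (-Complex.I * fderiv ℝ η x e + (a x : ℂ) * η x))
      (hm.coeFn_toLp.mono fun x hx => by simp only [hx])]
  rw [setIntegral_eq_integral_of_forall_compl_eq_zero fun x hx => by simp [z x hx],
    setIntegral_eq_integral_of_forall_compl_eq_zero fun x hx => by simp [z x hx]]
  have e1 : (fun x => (Complex.I * fderiv ℝ ψ x e + (a x : ℂ) * ψ x) * η x)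
      = fun x => Complex.I * (fderiv ℝ ψ x e * η x) + (a x : ℂ) * ψ x * η x := by
    ext x; ring
  have e2 : (fun x => ψ x * (-Complex.I * fderiv ℝ η x e + (a x : ℂ) * η x))
      = fun x => -Complex.I * (ψ x * fderiv ℝ η x e) + (a x : ℂ) * ψ x * η x := by
    ext x; ring
  rw [e1, e2, integral_add (i1.const_mul _) i4, integral_add (i2.const_mul _) i4,
    integral_const_mul, integral_const_mul, ibp]
  ring

theorem norm_toLp_sq {ψ : ℝ × ℝ → ℂ} (hm : MemLp ψ 2 (volume.restrict Ω)) :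
    ‖(hm.toLp : L2 Ω)‖ ^ 2 = ∫ x in Ω, ‖ψ x‖ ^ 2 := by
  rw [← inner_self_eq_norm_sq (𝕜 := ℂ), L2.inner_def, ← integral_re (L2.integrable_inner _ _)]
  refine integral_congr_ae (hm.coeFn_toLp.mono fun x hx => ?_)
  simp only [hx, inner_self_eq_norm_sq]

end Classical

/-! ### Polar coordinates on the wedge -/

theorem wedge_eq_image (φ : ℝ) :
    wedge φ = polarCoord.symm '' (Set.Ioi 0 ×ˢ Set.Ioo 0 φ) := by
  ext x
  simp only [wedge, Set.mem_ofPred_eq, Set.mem_image, Set.mem_prod, Set.mem_Ioi, Set.mem_Ioo,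
    Prod.exists, polarCoord_symm_apply]
  constructor
  · rintro ⟨r, θ, hr, h0, h1, rfl⟩
    exact ⟨r, θ, ⟨hr, h0, h1⟩, rfl⟩
  · rintro ⟨r, θ, ⟨hr, h0, h1⟩, rfl⟩
    exact ⟨r, θ, hr, h0, h1, rfl⟩

section Polar

variable {φ : ℝ} {F : ℝ × ℝ → ℝ} {f : ℝ × ℝ → ℝ}

theorem injOn_polarCoord_symm (hφ : φ ≤ Real.pi) :
    Set.InjOn polarCoord.symm (Set.Ioi 0 ×ˢ Set.Ioo 0 φ) := by
  refine polarCoord.symm.injOn.mono ?_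
  rintro ⟨r, θ⟩ ⟨hr, h0, h1⟩
  simp only [OpenPartialHomeomorph.symm_source, polarCoord_target]
  exact ⟨hr, by linarith [Real.pi_pos, (h0 : 0 < θ)], lt_of_lt_of_le h1 hφ⟩

theorem integrableOn_wedge (hφ : φ ≤ Real.pi)
    (hF : ∀ r > 0, ∀ θ ∈ Set.Ioo 0 φ, r * F (r * Real.cos θ, r * Real.sin θ) = f (r, θ))
    (hf : IntegrableOn f (Set.Ioi 0 ×ˢ Set.Ioo 0 φ)) : IntegrableOn F (wedge φ) := by
  rw [wedge_eq_image, integrableOn_image_iff_integrableOn_abs_det_fderiv_smul volume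
    (measurableSet_Ioi.prod measurableSet_Ioo)
    (fun p _ => (hasFDerivAt_polarCoord_symm p).hasFDerivWithinAt) (injOn_polarCoord_symm hφ)]
  refine hf.congr_fun (fun p hp => ?_) (measurableSet_Ioi.prod measurableSet_Ioo)
  simp only [det_fderivPolarCoordSymm, abs_of_pos (show 0 < p.1 from hp.1), smul_eq_mul,
    polarCoord_symm_apply, hF p.1 hp.1 p.2 hp.2]

theorem setIntegral_wedge (hφ : φ ≤ Real.pi)
    (hF : ∀ r > 0, ∀ θ ∈ Set.Ioo 0 φ, r * F (r * Real.cos θ, r * Real.sin θ) = f (r, θ)) :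
    ∫ x in wedge φ, F x = ∫ p in Set.Ioi 0 ×ˢ Set.Ioo 0 φ, f p := by
  rw [wedge_eq_image, integral_image_eq_integral_abs_det_fderiv_smul volume
    (measurableSet_Ioi.prod measurableSet_Ioo)
    (fun p _ => (hasFDerivAt_polarCoord_symm p).hasFDerivWithinAt) (injOn_polarCoord_symm hφ)]
  refine setIntegral_congr_fun (measurableSet_Ioi.prod measurableSet_Ioo) fun p hp => ?_
  simp only [det_fderivPolarCoordSymm, abs_of_pos (show 0 < p.1 from hp.1), smul_eq_mul,
    polarCoord_symm_apply, hF p.1 hp.1 p.2 hp.2]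

end Polar

/-! ### Gaussian moments -/

theorem integrableOn_pow_mul_exp_neg_sq {k : ℝ} (hk : 0 < k) (n : ℕ) :
    IntegrableOn (fun r : ℝ => r ^ n * Real.exp (-(k ^ 2 * r ^ 2))) (Set.Ioi 0) := by
  have h := integrableOn_rpow_mul_exp_neg_mul_sq (b := k ^ 2) (by positivity) (s := n)
    (by linarith [n.cast_nonneg (α := ℝ)])
  simpa only [Real.rpow_natCast, neg_mul] using h

theorem integral_pow_mul_exp_neg_sq {k : ℝ} (hk : 0 < k) (n : ℕ) :
    ∫ r in Set.Ioi (0 : ℝ), r ^ n * Real.exp (-(k ^ 2 * r ^ 2)) =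
      Real.Gamma ((n + 1) / 2) / (2 * k ^ (n + 1)) := by
  have h := integral_rpow_mul_exp_neg_mul_rpow (p := 2) (q := n) (b := k ^ 2) two_pos
    (by linarith [n.cast_nonneg (α := ℝ)]) (by positivity)
  have e : (k ^ 2) ^ (-((n : ℝ) + 1) / 2) = (k ^ (n + 1))⁻¹ := by
    rw [← Real.rpow_natCast k 2, ← Real.rpow_mul hk.le, ← Real.rpow_natCast k (n + 1),
      ← Real.rpow_neg hk.le]
    congr 1
    push_cast
    ring
  rw [e] at h
  simp only [Real.rpow_natCast, Real.rpow_ofNat, neg_mul] at h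
  rw [h]
  ring

theorem integral_one_moment {k : ℝ} (hk : 0 < k) :
    ∫ r in Set.Ioi (0 : ℝ), r ^ 1 * Real.exp (-(k ^ 2 * r ^ 2)) = 1 / (2 * k ^ 2) := by
  rw [integral_pow_mul_exp_neg_sq hk]
  norm_num

theorem integral_two_moment {k : ℝ} (hk : 0 < k) :
    ∫ r in Set.Ioi (0 : ℝ), r ^ 2 * Real.exp (-(k ^ 2 * r ^ 2)) = √Real.pi / (4 * k ^ 3) := by
  rw [integral_pow_mul_exp_neg_sq hk, show (((2 : ℕ) : ℝ) + 1) / 2 = 1 / 2 + 1 by norm_num,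
    Real.Gamma_add_one (by norm_num), Real.Gamma_one_half_eq]
  field_simp
  norm_num

theorem integral_three_moment {k : ℝ} (hk : 0 < k) :
    ∫ r in Set.Ioi (0 : ℝ), r ^ 3 * Real.exp (-(k ^ 2 * r ^ 2)) = 1 / (2 * k ^ 4) := by
  rw [integral_pow_mul_exp_neg_sq hk, show (((3 : ℕ) : ℝ) + 1) / 2 = 2 by norm_num,
    Real.Gamma_two]

/-! ### The trial function -/

/-- The Euclidean norm of `x ∈ ℝ²`. -/
noncomputable def radius (x : ℝ × ℝ) : ℝ := √(x.1 ^ 2 + x.2 ^ 2)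

/-- The polar angle of a point of the upper half-plane, which contains every wedge of aperture at
most `π`. It is given by the arctangent of the cotangent, a formula smooth there. -/
noncomputable def angle (x : ℝ × ℝ) : ℝ := Real.pi / 2 - Real.arctan (x.1 / x.2)

section HalfPlane

variable {x : ℝ × ℝ}

theorem radius_pos (hx : 0 < x.2) : 0 < radius x := Real.sqrt_pos.2 (by positivity)

theorem radius_sq (x : ℝ × ℝ) : radius x ^ 2 = x.1 ^ 2 + x.2 ^ 2 := Real.sq_sqrt (by positivity)

/-- The first coordinate, as a scalar function, with the base point explicit. -/
theorem hasFDerivAt_fst' (x : ℝ × ℝ) :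
    HasFDerivAt (Prod.fst : ℝ × ℝ → ℝ) (ContinuousLinearMap.fst ℝ ℝ ℝ) x := hasFDerivAt_fst

/-- The second coordinate, as a scalar function, with the base point explicit. -/
theorem hasFDerivAt_snd' (x : ℝ × ℝ) :
    HasFDerivAt (Prod.snd : ℝ × ℝ → ℝ) (ContinuousLinearMap.snd ℝ ℝ ℝ) x := hasFDerivAt_snd

theorem snd_pos_of_mem_wedge {φ : ℝ} (hφ : φ ≤ Real.pi) (hx : x ∈ wedge φ) : 0 < x.2 := by
  obtain ⟨r, θ, hr, h0, h1, rfl⟩ := hx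
  exact mul_pos hr (Real.sin_pos_of_pos_of_lt_pi h0 (by linarith))

theorem radius_polar {r : ℝ} (hr : 0 ≤ r) (θ : ℝ) :
    radius (r * Real.cos θ, r * Real.sin θ) = r := by
  rw [radius, show (r * Real.cos θ) ^ 2 + (r * Real.sin θ) ^ 2 = r ^ 2 by
    linear_combination r ^ 2 * Real.sin_sq_add_cos_sq θ, Real.sqrt_sq hr]

theorem angle_polar {r θ : ℝ} (hr : 0 < r) (h0 : 0 < θ) (h1 : θ < Real.pi) :
    angle (r * Real.cos θ, r * Real.sin θ) = θ := by
  have : r * Real.cos θ / (r * Real.sin θ) = Real.tan (Real.pi / 2 - θ) := by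
    rw [mul_div_mul_left _ _ hr.ne', Real.tan_eq_sin_div_cos, Real.sin_pi_div_two_sub,
      Real.cos_pi_div_two_sub]
  rw [angle, this, Real.arctan_tan (by linarith) (by linarith)]
  ring

theorem hasFDerivAt_radius (hx : 0 < x.2) :
    HasFDerivAt radius ((x.1 / radius x) • ContinuousLinearMap.fst ℝ ℝ ℝ +
      (x.2 / radius x) • ContinuousLinearMap.snd ℝ ℝ ℝ) x := by
  have h : HasFDerivAt (fun y : ℝ × ℝ => y.1 ^ 2 + y.2 ^ 2) _ x :=
    ((hasFDerivAt_fst' x).pow 2).add ((hasFDerivAt_snd' x).pow 2)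
  refine (h.sqrt (by positivity)).congr_fderiv ?_
  have hr := radius_pos hx
  ext <;> simp [radius] at hr ⊢ <;> field_simp

theorem hasFDerivAt_angle (hx : 0 < x.2) :
    HasFDerivAt angle ((-x.2 / radius x ^ 2) • ContinuousLinearMap.fst ℝ ℝ ℝ +
      (x.1 / radius x ^ 2) • ContinuousLinearMap.snd ℝ ℝ ℝ) x := by
  have h : HasFDerivAt (fun y : ℝ × ℝ => y.1 * y.2⁻¹) _ x :=
    (hasFDerivAt_fst' x).mul ((hasDerivAt_inv hx.ne').comp_hasFDerivAt x (hasFDerivAt_snd' x))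
  have h2 := (h.arctan).const_sub (Real.pi / 2)
  simp only [← div_eq_mul_inv] at h2
  refine h2.congr_fderiv ?_
  rw [radius_sq]
  have hp : 0 < x.1 ^ 2 + x.2 ^ 2 := by positivity
  ext <;> simp <;> field_simp <;> ring

theorem contDiffOn_radius : ContDiffOn ℝ 1 radius {x | 0 < x.2} := by
  refine ContDiffOn.sqrt (by fun_prop) fun x (hx : 0 < x.2) => by positivity

theorem contDiffOn_angle : ContDiffOn ℝ 1 angle {x | 0 < x.2} := by
  refine contDiffOn_const.sub (ContDiffOn.arctan ?_)
  exact contDiffOn_fst.div contDiffOn_snd fun x hx => ne_of_gt hx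

end HalfPlane

section Trial

/-- The phase `r² c(θ) + r B(θ) / k` of the trial function. -/
noncomputable def trialPhase (k : ℝ) (B c : ℝ → ℝ) (x : ℝ × ℝ) : ℝ :=
  radius x ^ 2 * c (angle x) + radius x * B (angle x) / k

/-- The trial function `exp (-k² r² / 2 + i (r² c(θ) + r B(θ) / k))`. -/
noncomputable def trialFunction (k : ℝ) (B c : ℝ → ℝ) (x : ℝ × ℝ) : ℂ :=
  Complex.exp ((-(k ^ 2 * (x.1 ^ 2 + x.2 ^ 2)) / 2 : ℝ) + Complex.I * trialPhase k B c x)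

/-- The radial derivative of the phase. -/
noncomputable def phaseRadial (k : ℝ) (B c : ℝ → ℝ) (x : ℝ × ℝ) : ℝ :=
  2 * radius x * c (angle x) + B (angle x) / k

/-- The angular derivative of the phase, divided by `r²`. -/
noncomputable def phaseAngular (k : ℝ) (B' c' : ℝ → ℝ) (x : ℝ × ℝ) : ℝ :=
  c' (angle x) + B' (angle x) / (radius x * k)

variable {k : ℝ} {B c B' c' : ℝ → ℝ}

theorem hasFDerivAt_trialPhase (hB : ∀ θ, HasDerivAt B (B' θ) θ) (hc : ∀ θ, HasDerivAt c (c' θ) θ)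
    {x : ℝ × ℝ} (hx : 0 < x.2) :
    HasFDerivAt (trialPhase k B c)
      ((phaseRadial k B c x * (x.1 / radius x) - phaseAngular k B' c' x * x.2) •
          ContinuousLinearMap.fst ℝ ℝ ℝ +
        (phaseRadial k B c x * (x.2 / radius x) + phaseAngular k B' c' x * x.1) •
          ContinuousLinearMap.snd ℝ ℝ ℝ) x := by
  have hr := radius_pos hx
  have h1 := hasFDerivAt_radius hx
  have h2 := hasFDerivAt_angle hx
  have h := ((h1.pow 2).mul ((hc _).comp_hasFDerivAt x h2)).add
    ((h1.mul ((hB _).comp_hasFDerivAt x h2)).mul_const k⁻¹)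
  simp only [← div_eq_mul_inv] at h
  refine h.congr_fderiv ?_
  ext <;> simp [phaseRadial, phaseAngular] <;> field_simp <;> ring

theorem fderiv_trialFunction (hB : ∀ θ, HasDerivAt B (B' θ) θ)
    (hc : ∀ θ, HasDerivAt c (c' θ) θ) {x : ℝ × ℝ} (hx : 0 < x.2) (e : ℝ × ℝ) :
    fderiv ℝ (trialFunction k B c) x e = trialFunction k B c x *
      ((-(k ^ 2 * (x.1 * e.1 + x.2 * e.2)) : ℝ) + Complex.I *
        ((phaseRadial k B c x * (x.1 / radius x) - phaseAngular k B' c' x * x.2) * e.1 +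
        (phaseRadial k B c x * (x.2 / radius x) + phaseAngular k B' c' x * x.1) * e.2 : ℝ)) := by
  have h0 : HasFDerivAt (fun y : ℝ × ℝ => -(k ^ 2 * (y.1 ^ 2 + y.2 ^ 2)) * 2⁻¹) _ x :=
    ((((hasFDerivAt_fst' x).pow 2).add ((hasFDerivAt_snd' x).pow 2)).const_mul
      (k ^ 2)).neg.mul_const _
  simp only [← div_eq_mul_inv] at h0
  have h1 := (Complex.ofRealCLM.hasFDerivAt.comp x h0).add
    ((Complex.ofRealCLM.hasFDerivAt.comp x (hasFDerivAt_trialPhase (k := k) hB hc hx)).const_mul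
      Complex.I)
  have h2 : HasFDerivAt (trialFunction k B c) _ x := h1.cexp
  rw [h2.fderiv]
  simp [trialFunction]
  ring

theorem contDiffOn_trialFunction (hB : ContDiff ℝ 1 B) (hc : ContDiff ℝ 1 c) :
    ContDiffOn ℝ 1 (trialFunction k B c) {x | 0 < x.2} := by
  have h1 : ContDiffOn ℝ 1 (trialPhase k B c) {x | 0 < x.2} :=
    ((contDiffOn_radius.pow 2).mul (hc.comp_contDiffOn contDiffOn_angle)).add
      ((contDiffOn_radius.mul (hB.comp_contDiffOn contDiffOn_angle)).div_const k)
  refine ContDiffOn.cexp (ContDiffOn.add ?_ (contDiffOn_const.mul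
    (Complex.ofRealCLM.contDiff.comp_contDiffOn h1)))
  have h2 : ContDiff ℝ 1 fun x : ℝ × ℝ => -(k ^ 2 * (x.1 ^ 2 + x.2 ^ 2)) / 2 := by fun_prop
  exact (Complex.ofRealCLM.contDiff.comp h2).contDiffOn

theorem norm_sq_trialFunction (x : ℝ × ℝ) :
    ‖trialFunction k B c x‖ ^ 2 = Real.exp (-(k ^ 2 * (x.1 ^ 2 + x.2 ^ 2))) := by
  rw [trialFunction, Complex.norm_exp, sq, ← Real.exp_add]
  congr 1
  rw [Complex.add_re, Complex.ofReal_re, Complex.I_mul_re, Complex.ofReal_im]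
  ring

/-- The pointwise energy density of the trial function. In the orthonormal frame of polar
coordinates the potential is `(0, r / 2)` and the gradient of the phase is `(p, r q)`, with `p` the
radial derivative and `r² q` the angular derivative. -/
theorem norm_sq_magneticGradient_trialFunction (hB : ∀ θ, HasDerivAt B (B' θ) θ)
    (hc : ∀ θ, HasDerivAt c (c' θ) θ) {x : ℝ × ℝ} (hx : 0 < x.2) :
    ‖Complex.I * fderiv ℝ (trialFunction k B c) x (1, 0) +
        ((vectorPotential x).1 : ℂ) * trialFunction k B c x‖ ^ 2 +
      ‖Complex.I * fderiv ℝ (trialFunction k B c) x (0, 1) +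
        ((vectorPotential x).2 : ℂ) * trialFunction k B c x‖ ^ 2 =
    Real.exp (-(k ^ 2 * (x.1 ^ 2 + x.2 ^ 2))) * (k ^ 4 * radius x ^ 2 + phaseRadial k B c x ^ 2 +
      (radius x * (1 / 2 - phaseAngular k B' c' x)) ^ 2) := by
  have hr := radius_pos hx
  have hr2 := radius_sq x
  rw [fderiv_trialFunction hB hc hx, fderiv_trialFunction hB hc hx]
  set p := phaseRadial k B c x
  set q := phaseAngular k B' c' x
  set u := trialFunction k B c x with hu
  have key : ∀ s t a : ℝ, ‖Complex.I * (u * ((s : ℂ) + Complex.I * (t : ℂ))) + (a : ℂ) * u‖ ^ 2 =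
      ‖u‖ ^ 2 * (s ^ 2 + (a - t) ^ 2) := by
    intro s t a
    have : Complex.I * (u * ((s : ℂ) + Complex.I * (t : ℂ))) + (a : ℂ) * u =
        u * (((a - t : ℝ) : ℂ) + (s : ℝ) * Complex.I) := by
      push_cast
      linear_combination u * (t : ℂ) * Complex.I_sq
    rw [this, norm_mul, mul_pow, Complex.sq_norm, Complex.sq_norm, Complex.normSq_add_mul_I]
    ring
  rw [key, key, norm_sq_trialFunction, ← mul_add]
  congr 1
  -- `(m₁, m₂)` is the radial unit vector.
  obtain ⟨m₁, hm₁⟩ : ∃ m, x.1 / radius x = m := ⟨_, rfl⟩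
  obtain ⟨m₂, hm₂⟩ : ∃ m, x.2 / radius x = m := ⟨_, rfl⟩
  have e₁ : x.1 = m₁ * radius x := (div_eq_iff hr.ne').1 hm₁
  have e₂ : x.2 = m₂ * radius x := (div_eq_iff hr.ne').1 hm₂
  have hm : m₁ ^ 2 + m₂ ^ 2 = 1 := by
    rw [← hm₁, ← hm₂, div_pow, div_pow, hr2]
    field_simp
  simp only [vectorPotential, hm₁, hm₂]
  rw [e₁, e₂]
  linear_combination (k ^ 4 * radius x ^ 2 + radius x ^ 2 * (1 / 2 - q) ^ 2 + p ^ 2) * hm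

end Trial

/-! ### The energy of the trial function -/

section Energy

variable {k φ : ℝ}

theorem integrableOn_gaussian_mul (hk : 0 < k) (n : ℕ) {E : ℝ → ℝ} (hE : Continuous E) :
    IntegrableOn (fun p : ℝ × ℝ => p.1 ^ n * Real.exp (-(k ^ 2 * p.1 ^ 2)) * E p.2)
      (Set.Ioi 0 ×ˢ Set.Ioo 0 φ) := by
  have h : IntegrableOn E (Set.Ioo 0 φ) :=
    (hE.continuousOn.integrableOn_Icc (μ := volume)).mono_set Set.Ioo_subset_Icc_self
  rw [IntegrableOn, Measure.volume_eq_prod, ← Measure.prod_restrict]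
  exact (integrableOn_pow_mul_exp_neg_sq hk n).mul_prod h

theorem setIntegral_gaussian_mul (hφ : 0 ≤ φ) (n : ℕ) (E : ℝ → ℝ) :
    ∫ p in Set.Ioi 0 ×ˢ Set.Ioo 0 φ, p.1 ^ n * Real.exp (-(k ^ 2 * p.1 ^ 2)) * E p.2 =
      (∫ r in Set.Ioi 0, r ^ n * Real.exp (-(k ^ 2 * r ^ 2))) * ∫ θ in 0..φ, E θ := by
  rw [Measure.volume_eq_prod, setIntegral_prod_mul
    (fun r : ℝ => r ^ n * Real.exp (-(k ^ 2 * r ^ 2))), intervalIntegral.integral_of_le hφ,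
    integral_Ioc_eq_integral_Ioo]

/-- The angular energy density: the weights `1 : √π / 2 : 1` are the ratios of the radial moments
of orders `3`, `2` and `1` for `k = 1`. -/
noncomputable def angularDensity (B B' c c' : ℝ → ℝ) (θ : ℝ) : ℝ :=
  4 * c θ ^ 2 + (1 / 2 - c' θ) ^ 2 +
    √Real.pi / 2 * (4 * c θ * B θ - 2 * (1 / 2 - c' θ) * B' θ) + (B θ ^ 2 + B' θ ^ 2)

/-- The mass and the energy of the trial function. The factor `1 / k` in front of `B` makes the
angular integral independent of `k`. -/
theorem exists_mem_graphSpace_of_angularDensity (hk : 0 < k) (hφ₀ : 0 < φ) (hφ : φ ≤ Real.pi)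
    {B B' c c' : ℝ → ℝ} (hB : ∀ θ, HasDerivAt B (B' θ) θ) (hB' : Continuous B')
    (hc : ∀ θ, HasDerivAt c (c' θ) θ) (hc' : Continuous c') :
    ∃ p ∈ graphSpace (wedge φ), ‖p.fst‖ ^ 2 = φ / (2 * k ^ 2) ∧
      ‖p.snd‖ ^ 2 = φ / 2 + (∫ θ in 0..φ, angularDensity B B' c c' θ) / (2 * k ^ 4) := by
  have hΩ := isOpen_wedge hφ
  have hpos : wedge φ ⊆ {x | 0 < x.2} := fun x hx => snd_pos_of_mem_wedge hφ hx
  have hcB : Continuous B := continuous_iff_continuousAt.2 fun θ => (hB θ).continuousAt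
  have hcc : Continuous c := continuous_iff_continuousAt.2 fun θ => (hc θ).continuousAt
  have hB1 : ContDiff ℝ 1 B := contDiff_one_iff_deriv.2
    ⟨fun θ => (hB θ).differentiableAt, by rwa [funext fun θ => (hB θ).deriv]⟩
  have hc1 : ContDiff ℝ 1 c := contDiff_one_iff_deriv.2
    ⟨fun θ => (hc θ).differentiableAt, by rwa [funext fun θ => (hc θ).deriv]⟩
  set u := trialFunction k B c with hu
  have hu1 : ContDiffOn ℝ 1 u (wedge φ) := (contDiffOn_trialFunction hB1 hc1).mono hpos
  set g₁ := fun x => Complex.I * fderiv ℝ u x (1, 0) + ((vectorPotential x).1 : ℂ) * u x with hg₁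
  set g₂ := fun x => Complex.I * fderiv ℝ u x (0, 1) + ((vectorPotential x).2 : ℂ) * u x with hg₂
  have hcont : ∀ (e : ℝ × ℝ) (a : ℝ × ℝ → ℝ), Continuous a → AEStronglyMeasurable
      (fun x => Complex.I * fderiv ℝ u x e + (a x : ℂ) * u x) (volume.restrict (wedge φ)) := by
    intro e a ha
    refine ContinuousOn.aestronglyMeasurable ?_ hΩ.measurableSet
    exact (continuousOn_const.mul ((hu1.continuousOn_fderiv_of_isOpen hΩ le_rfl).clm_apply
      continuousOn_const)).add ((Complex.continuous_ofReal.comp ha).continuousOn.mul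
        hu1.continuousOn)
  have hm₁ := hcont (1, 0) _ (continuous_fst.comp continuous_vectorPotential)
  have hm₂ := hcont (0, 1) _ (continuous_snd.comp continuous_vectorPotential)
  -- The densities of mass and energy in polar coordinates; the latter is sorted by powers of `r`,
  -- with angular coefficients `E₂`, `E₁`, `E₀`.
  obtain ⟨fm, hfm⟩ : ∃ f : ℝ × ℝ → ℝ,
      f = fun p => p.1 ^ 1 * Real.exp (-(k ^ 2 * p.1 ^ 2)) * 1 := ⟨_, rfl⟩
  have hmass : ∀ r > 0, ∀ θ ∈ Set.Ioo 0 φ,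
      r * (fun x => ‖u x‖ ^ 2) (r * Real.cos θ, r * Real.sin θ) = fm (r, θ) := by
    intro r hr θ _
    simp only [hfm]
    rw [norm_sq_trialFunction, ← radius_sq, radius_polar hr.le]
    ring
  set E₂ : ℝ → ℝ := fun θ => k ^ 4 + 4 * c θ ^ 2 + (1 / 2 - c' θ) ^ 2 with hE₂
  set E₁ : ℝ → ℝ := fun θ => (4 * c θ * B θ - 2 * (1 / 2 - c' θ) * B' θ) / k with hE₁
  set E₀ : ℝ → ℝ := fun θ => (B θ ^ 2 + B' θ ^ 2) / k ^ 2 with hE₀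
  have hE₂c : Continuous E₂ := by fun_prop
  have hE₁c : Continuous E₁ := by fun_prop
  have hE₀c : Continuous E₀ := by fun_prop
  obtain ⟨fe, hfe⟩ : ∃ f : ℝ × ℝ → ℝ, f = fun p =>
      p.1 ^ 3 * Real.exp (-(k ^ 2 * p.1 ^ 2)) * E₂ p.2 +
        p.1 ^ 2 * Real.exp (-(k ^ 2 * p.1 ^ 2)) * E₁ p.2 +
        p.1 ^ 1 * Real.exp (-(k ^ 2 * p.1 ^ 2)) * E₀ p.2 := ⟨_, rfl⟩
  have henergy : ∀ r > 0, ∀ θ ∈ Set.Ioo 0 φ,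
      r * (fun x => ‖g₁ x‖ ^ 2 + ‖g₂ x‖ ^ 2) (r * Real.cos θ, r * Real.sin θ) = fe (r, θ) := by
    intro r hr θ hθ
    have hx : 0 < r * Real.sin θ :=
      mul_pos hr (Real.sin_pos_of_pos_of_lt_pi hθ.1 (by linarith [hθ.2]))
    have h := norm_sq_magneticGradient_trialFunction (k := k) hB hc
      (x := (r * Real.cos θ, r * Real.sin θ)) hx
    simp only [hg₁, hg₂, hfe]
    rw [h, ← radius_sq, phaseRadial, phaseAngular, radius_polar hr.le,
      angle_polar hr hθ.1 (by linarith [hθ.2])]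
    simp only [hE₂, hE₁, hE₀]
    field_simp
    ring
  have i3 := integrableOn_gaussian_mul (φ := φ) hk 3 hE₂c
  have i2 := integrableOn_gaussian_mul (φ := φ) hk 2 hE₁c
  have i1 := integrableOn_gaussian_mul (φ := φ) hk 1 hE₀c
  have i32 : IntegrableOn (fun p : ℝ × ℝ => p.1 ^ 3 * Real.exp (-(k ^ 2 * p.1 ^ 2)) * E₂ p.2 +
      p.1 ^ 2 * Real.exp (-(k ^ 2 * p.1 ^ 2)) * E₁ p.2) (Set.Ioi 0 ×ˢ Set.Ioo 0 φ) := i3.add i2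
  have imass : IntegrableOn (fun x => ‖u x‖ ^ 2) (wedge φ) := integrableOn_wedge hφ hmass
    (hfm ▸ integrableOn_gaussian_mul hk 1 (E := fun _ => 1) continuous_const)
  have ienergy : IntegrableOn (fun x => ‖g₁ x‖ ^ 2 + ‖g₂ x‖ ^ 2) (wedge φ) :=
    integrableOn_wedge hφ henergy (hfe ▸ i32.add i1)
  have vmass := setIntegral_wedge (F := fun x => ‖u x‖ ^ 2) (f := fm) hφ hmass
  have venergy := setIntegral_wedge (F := fun x => ‖g₁ x‖ ^ 2 + ‖g₂ x‖ ^ 2) (f := fe) hφ henergy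
  simp only [hfm] at vmass
  simp only [hfe] at venergy
  rw [setIntegral_gaussian_mul hφ₀.le 1 fun _ => 1, integral_one_moment hk] at vmass
  rw [integral_add i32 i1, integral_add i3 i2, setIntegral_gaussian_mul hφ₀.le 3,
    setIntegral_gaussian_mul hφ₀.le 2, setIntegral_gaussian_mul hφ₀.le 1, integral_one_moment hk,
    integral_two_moment hk, integral_three_moment hk] at venergy
  have Lu : MemLp u 2 (volume.restrict (wedge φ)) :=
    (memLp_two_iff_integrable_sq_norm (hu1.continuousOn.aestronglyMeasurable
      hΩ.measurableSet)).2 imass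
  have j₁ : IntegrableOn (fun x => ‖g₁ x‖ ^ 2) (wedge φ) :=
    Integrable.mono' ienergy (hm₁.norm.pow 2) (Filter.Eventually.of_forall fun x => by
      rw [Real.norm_of_nonneg (by positivity)]
      exact le_add_of_nonneg_right (by positivity))
  have j₂ : IntegrableOn (fun x => ‖g₂ x‖ ^ 2) (wedge φ) :=
    Integrable.mono' ienergy (hm₂.norm.pow 2) (Filter.Eventually.of_forall fun x => by
      rw [Real.norm_of_nonneg (by positivity)]
      exact le_add_of_nonneg_left (by positivity))
  have L₁ : MemLp g₁ 2 (volume.restrict (wedge φ)) := (memLp_two_iff_integrable_sq_norm hm₁).2 j₁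
  have L₂ : MemLp g₂ 2 (volume.restrict (wedge φ)) := (memLp_two_iff_integrable_sq_norm hm₂).2 j₂
  refine ⟨WithLp.toLp 2 (Lu.toLp, WithLp.toLp 2 (L₁.toLp, L₂.toLp)),
    ⟨isMagneticPartial_of_contDiffOn hΩ hu1 _ (continuous_fst.comp continuous_vectorPotential)
        Lu L₁,
      isMagneticPartial_of_contDiffOn hΩ hu1 _ (continuous_snd.comp continuous_vectorPotential)
        Lu L₂⟩, ?_, ?_⟩
  · refine (norm_toLp_sq Lu).trans (vmass.trans ?_)
    rw [intervalIntegral.integral_const, smul_eq_mul]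
    ring
  · refine (WithLp.prod_norm_sq_eq_of_L2 _).trans
      ((congrArg₂ (· + ·) (norm_toLp_sq L₁) (norm_toLp_sq L₂)).trans ?_)
    rw [← integral_add j₁ j₂, venergy]
    have ii : ∀ E : ℝ → ℝ, Continuous E → IntervalIntegrable E volume 0 φ :=
      fun E hE => hE.intervalIntegrable _ _
    have w : ∫ θ in 0..φ, angularDensity B B' c c' θ =
        (∫ θ in 0..φ, E₂ θ) - (∫ _θ in 0..φ, k ^ 4) + k * √Real.pi / 2 * (∫ θ in 0..φ, E₁ θ) +
          k ^ 2 * ∫ θ in 0..φ, E₀ θ := by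
      rw [← intervalIntegral.integral_const_mul, ← intervalIntegral.integral_const_mul,
        ← intervalIntegral.integral_sub (ii _ hE₂c) (ii _ continuous_const),
        ← intervalIntegral.integral_add (ii (fun θ => E₂ θ - k ^ 4) (by fun_prop))
          (ii (fun θ => k * √Real.pi / 2 * E₁ θ) (by fun_prop)),
        ← intervalIntegral.integral_add
          (ii (fun θ => E₂ θ - k ^ 4 + k * √Real.pi / 2 * E₁ θ) (by fun_prop))
          (ii (fun θ => k ^ 2 * E₀ θ) (by fun_prop))]
      congr 1
      ext θ
      simp only [angularDensity, hE₂, hE₁, hE₀]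
      field_simp
      ring
    rw [w, intervalIntegral.integral_const, smul_eq_mul]
    field_simp
    ring

end Energy

/-! ### The optimal phase -/

section Phase

variable {φ : ℝ}

/-- For a solution of the Euler-Lagrange equations with natural boundary conditions, the energy is
given by the boundary values: the quadratic part of the density is the derivative of
`B (B' + α c') + c (c' + α B')` with `α = √π / 2`. -/
theorem integral_angularDensity {B B' B'' c c' c'' : ℝ → ℝ}
    (hB : ∀ θ, HasDerivAt B (B' θ) θ) (hB' : ∀ θ, HasDerivAt B' (B'' θ) θ)
    (hc : ∀ θ, HasDerivAt c (c' θ) θ) (hc' : ∀ θ, HasDerivAt c' (c'' θ) θ)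
    (el₁ : ∀ θ, B'' θ + √Real.pi / 2 * c'' θ = B θ + √Real.pi * c θ)
    (el₂ : ∀ θ, c'' θ + √Real.pi / 2 * B'' θ = 4 * c θ + √Real.pi * B θ)
    (b₀ : B' 0 = 0) (b₁ : B' φ = 0) (c₀ : c' 0 = 1 / 2) (c₁ : c' φ = 1 / 2) :
    ∫ θ in 0..φ, angularDensity B B' c c' θ =
      φ / 4 - (c φ + √Real.pi / 2 * B φ - (c 0 + √Real.pi / 2 * B 0)) / 2 := by
  have hcont : ∀ {f f' : ℝ → ℝ}, (∀ θ, HasDerivAt f (f' θ) θ) → Continuous f := fun h =>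
    continuous_iff_continuousAt.2 fun θ => (h θ).continuousAt
  have h1 := hcont hB
  have h2 := hcont hB'
  have h3 := hcont hc
  have h4 := hcont hc'
  have hd : ∀ θ ∈ Set.uIcc 0 φ, HasDerivAt (fun θ => B θ * (B' θ + √Real.pi / 2 * c' θ) +
      c θ * (c' θ + √Real.pi / 2 * B' θ) - c θ - √Real.pi / 2 * B θ + 1 / 4 * θ)
      (angularDensity B B' c c' θ) θ := by
    intro θ _
    have h := (((((hB θ).mul ((hB' θ).add ((hc' θ).const_mul (√Real.pi / 2)))).add
      ((hc θ).mul ((hc' θ).add ((hB' θ).const_mul (√Real.pi / 2))))).sub (hc θ)).sub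
      ((hB θ).const_mul (√Real.pi / 2))).add ((hasDerivAt_id θ).const_mul (1 / 4))
    refine h.congr_deriv ?_
    simp only [angularDensity, Pi.add_apply]
    linear_combination B θ * el₁ θ + c θ * el₂ θ
  rw [intervalIntegral.integral_eq_sub_of_hasDerivAt hd
    (Continuous.intervalIntegrable (by unfold angularDensity; fun_prop) _ _)]
  simp only [b₀, b₁, c₀, c₁]
  ring

/-- The odd combination of two hyperbolic modes centred at the axis of the wedge. -/
noncomputable def sinhMode (φ m₁ m₂ a₁ a₂ θ : ℝ) : ℝ :=
  a₁ * Real.sinh (m₁ * (θ - φ / 2)) + a₂ * Real.sinh (m₂ * (θ - φ / 2))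

/-- The even combination of two hyperbolic modes centred at the axis of the wedge. -/
noncomputable def coshMode (φ m₁ m₂ a₁ a₂ θ : ℝ) : ℝ :=
  a₁ * Real.cosh (m₁ * (θ - φ / 2)) + a₂ * Real.cosh (m₂ * (θ - φ / 2))

theorem hasDerivAt_sinhMode (m₁ m₂ a₁ a₂ θ : ℝ) : HasDerivAt (sinhMode φ m₁ m₂ a₁ a₂)
    (coshMode φ m₁ m₂ (m₁ * a₁) (m₂ * a₂) θ) θ := by
  have h : ∀ m, HasDerivAt (fun θ => m * (θ - φ / 2)) m θ := fun m => by
    simpa using ((hasDerivAt_id θ).sub_const (φ / 2)).const_mul m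
  refine (((h m₁).sinh.const_mul a₁).add ((h m₂).sinh.const_mul a₂)).congr_deriv ?_
  rw [coshMode]
  ring

theorem hasDerivAt_coshMode (m₁ m₂ a₁ a₂ θ : ℝ) : HasDerivAt (coshMode φ m₁ m₂ a₁ a₂)
    (sinhMode φ m₁ m₂ (m₁ * a₁) (m₂ * a₂) θ) θ := by
  have h : ∀ m, HasDerivAt (fun θ => m * (θ - φ / 2)) m θ := fun m => by
    simpa using ((hasDerivAt_id θ).sub_const (φ / 2)).const_mul m
  refine (((h m₁).cosh.const_mul a₁).add ((h m₂).cosh.const_mul a₂)).congr_deriv ?_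
  rw [sinhMode]
  ring

/-- The Euler-Lagrange system is solved by the modes whose exponents `m` satisfy the characteristic
equation `(m² - 4) (m² - 1) = π / 4 (m² - 2)²`; the weights `w₁`, `w₂` are fixed by the boundary
conditions. -/
theorem exists_integral_angularDensity_eq {m₁ m₂ w₁ w₂ : ℝ} (hm₁ : m₁ ≠ 0) (hm₂ : m₂ ≠ 0)
    (e₁ : (m₁ ^ 2 - 4) * (m₁ ^ 2 - 1) = Real.pi / 4 * (m₁ ^ 2 - 2) ^ 2)
    (e₂ : (m₂ ^ 2 - 4) * (m₂ ^ 2 - 1) = Real.pi / 4 * (m₂ ^ 2 - 2) ^ 2)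
    (hw₁ : w₁ + w₂ = 1 / 2) (hw₂ : w₁ * m₁ ^ 2 + w₂ * m₂ ^ 2 = 1) :
    ∃ B B' c c' : ℝ → ℝ, (∀ θ, HasDerivAt B (B' θ) θ) ∧ Continuous B' ∧
      (∀ θ, HasDerivAt c (c' θ) θ) ∧ Continuous c' ∧
      ∫ θ in 0..φ, angularDensity B B' c c' θ = φ / 4 -
        (w₁ / m₁ * ((m₁ ^ 2 - 1) - Real.pi / 4 * (m₁ ^ 2 - 2)) * Real.tanh (m₁ * φ / 2) +
        w₂ / m₂ * ((m₂ ^ 2 - 1) - Real.pi / 4 * (m₂ ^ 2 - 2)) * Real.tanh (m₂ * φ / 2)) := by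
  set α := √Real.pi / 2 with hα
  have hα2 : Real.pi / 4 = α ^ 2 := by
    rw [hα, div_pow, Real.sq_sqrt Real.pi_pos.le]; norm_num
  have hsp : √Real.pi = 2 * α := by rw [hα]; ring
  rw [hα2] at e₁ e₂ ⊢
  have hC₁ : Real.cosh (m₁ * φ / 2) ≠ 0 := (Real.cosh_pos _).ne'
  have hC₂ : Real.cosh (m₂ * φ / 2) ≠ 0 := (Real.cosh_pos _).ne'
  set k₁ := w₁ / (m₁ * Real.cosh (m₁ * φ / 2)) with hk₁
  set k₂ := w₂ / (m₂ * Real.cosh (m₂ * φ / 2)) with hk₂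
  have hk₁' : k₁ * (m₁ * Real.cosh (m₁ * φ / 2)) = w₁ := div_mul_cancel₀ _ (mul_ne_zero hm₁ hC₁)
  have hk₂' : k₂ * (m₂ * Real.cosh (m₂ * φ / 2)) = w₂ := div_mul_cancel₀ _ (mul_ne_zero hm₂ hC₂)
  have r₁ : ∀ m : ℝ, m * (0 - φ / 2) = -(m * φ / 2) := fun m => by ring
  have r₂ : ∀ m : ℝ, m * (φ - φ / 2) = m * φ / 2 := fun m => by ring
  have hcont : ∀ m₁ m₂ a₁ a₂ : ℝ, Continuous (coshMode φ m₁ m₂ a₁ a₂) := fun m₁ m₂ a₁ a₂ =>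
    continuous_iff_continuousAt.2 fun θ => (hasDerivAt_coshMode m₁ m₂ a₁ a₂ θ).continuousAt
  refine ⟨sinhMode φ m₁ m₂ (-α * (m₁ ^ 2 - 2) * k₁) (-α * (m₂ ^ 2 - 2) * k₂), _,
    sinhMode φ m₁ m₂ ((m₁ ^ 2 - 1) * k₁) ((m₂ ^ 2 - 1) * k₂), _,
    hasDerivAt_sinhMode _ _ _ _, hcont _ _ _ _, hasDerivAt_sinhMode _ _ _ _, hcont _ _ _ _, ?_⟩
  refine (integral_angularDensity (hasDerivAt_sinhMode _ _ _ _) (hasDerivAt_coshMode _ _ _ _)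
    (hasDerivAt_sinhMode _ _ _ _) (hasDerivAt_coshMode _ _ _ _) (fun θ => ?_) (fun θ => ?_)
    ?_ ?_ ?_ ?_).trans ?_
  · simp only [sinhMode, hsp]
    ring
  · simp only [sinhMode, hsp]
    linear_combination k₁ * Real.sinh (m₁ * (θ - φ / 2)) * e₁ +
      k₂ * Real.sinh (m₂ * (θ - φ / 2)) * e₂
  · simp only [coshMode, r₁, Real.cosh_neg]
    linear_combination -α * (m₁ ^ 2 - 2) * hk₁' - α * (m₂ ^ 2 - 2) * hk₂' - α * hw₂ + 2 * α * hw₁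
  · simp only [coshMode, r₂]
    linear_combination -α * (m₁ ^ 2 - 2) * hk₁' - α * (m₂ ^ 2 - 2) * hk₂' - α * hw₂ + 2 * α * hw₁
  · simp only [coshMode, r₁, Real.cosh_neg]
    linear_combination (m₁ ^ 2 - 1) * hk₁' + (m₂ ^ 2 - 1) * hk₂' + hw₂ - hw₁
  · simp only [coshMode, r₂]
    linear_combination (m₁ ^ 2 - 1) * hk₁' + (m₂ ^ 2 - 1) * hk₂' + hw₂ - hw₁
  · simp only [sinhMode, r₁, r₂, Real.sinh_neg, Real.tanh_eq_sinh_div_cosh]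
    rw [← hα, ← hk₁', ← hk₂']
    field_simp
    ring

end Phase

end MagneticWedge

theorem mainTheorem2 (s μ₁ μ₂ ν₁ ν₂ : ℝ)
    (hs : s = Real.sqrt (9 - 2 * Real.pi))
    (hμ₁ : μ₁ = (s + 1) / Real.sqrt (4 - Real.pi))
    (hμ₂ : μ₂ = (s - 1) / Real.sqrt (4 - Real.pi))
    (hν₁ : ν₁ = Real.sqrt (4 - Real.pi) * (3 - Real.pi + s) / (2 * (1 + s)))
    (hν₂ : ν₂ = Real.sqrt (4 - Real.pi) * (3 - Real.pi - s) / (2 * (1 - s)))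
    (φ : ℝ) (hφ₀ : 0 < φ) (hφ₁ : φ < Real.pi)
    (hcond : 2 * φ * s * MagneticWedge.thetaN φ ^ 2 *
      (2 * φ * s - μ₁ ^ 2 * μ₂ ^ 2 *
        (ν₁ * Real.tanh (μ₁ * φ / 2) + ν₂ * Real.tanh (μ₂ * φ / 2)))⁻¹ > 1) :
    ∃ t : ℝ, t < MagneticWedge.thetaN φ ∧
      (t : ℂ) ∈ MagneticWedge.discreteSpectrum
        (MagneticWedge.magneticNeumannLaplacian (MagneticWedge.wedge φ)) := by
  have hπ := Real.pi_lt_d2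
  obtain ⟨q, hq⟩ : ∃ q, √(4 - Real.pi) = q := ⟨_, rfl⟩
  have hq0 : 0 < q := hq ▸ Real.sqrt_pos.2 (by linarith)
  have hq2 : q ^ 2 = 4 - Real.pi := hq ▸ Real.sq_sqrt (by linarith)
  have hs2 : s ^ 2 = 9 - 2 * Real.pi := hs ▸ Real.sq_sqrt (by linarith)
  have hs1 : 1 < s := hs ▸ Real.lt_sqrt_of_sq_lt (by linarith)
  have hs0 : 0 < s := by linarith
  have hs1' : s - 1 ≠ 0 := by linarith
  -- Everything is expressed through `s`, eliminating `π` and `√(4 - π)`.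
  have hπs : Real.pi = (9 - s ^ 2) / 2 := by linarith
  have hq2' : q ^ 2 = (s ^ 2 - 1) / 2 := by linarith
  rw [hq] at hμ₁ hμ₂ hν₁ hν₂
  have hμ₁0 : μ₁ ≠ 0 := by rw [hμ₁]; positivity
  have hμ₂0 : μ₂ ≠ 0 := by rw [hμ₂]; exact div_ne_zero hs1' hq0.ne'
  have m₁ : μ₁ ^ 2 = 2 * (s + 1) / (s - 1) := by
    rw [hμ₁, div_pow, hq2', show s ^ 2 - 1 = (s - 1) * (s + 1) by ring]
    field_simp
  have m₂ : μ₂ ^ 2 = 2 * (s - 1) / (s + 1) := by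
    rw [hμ₂, div_pow, hq2', show s ^ 2 - 1 = (s - 1) * (s + 1) by ring]
    field_simp
  -- The weights solve the two linear boundary conditions.
  obtain ⟨B, B', c, c', hB, hB', hc, hc', hI⟩ :=
    MagneticWedge.exists_integral_angularDensity_eq (φ := φ) (m₁ := μ₁) (m₂ := μ₂)
    (w₁ := (s - 1) / (4 * s)) (w₂ := (s + 1) / (4 * s)) hμ₁0 hμ₂0
    (by rw [m₁, hπs]; field_simp; ring) (by rw [m₂, hπs]; field_simp; ring)
    (by field_simp; ring) (by rw [m₁, m₂]; field_simp; ring)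
  set D := 2 * φ * s - μ₁ ^ 2 * μ₂ ^ 2 *
    (ν₁ * Real.tanh (μ₁ * φ / 2) + ν₂ * Real.tanh (μ₂ * φ / 2)) with hD
  have hID : ∫ θ in 0..φ, MagneticWedge.angularDensity B B' c c' θ = D / (8 * s) := by
    have n₁ : (s - 1) / (4 * s) / μ₁ * ((μ₁ ^ 2 - 1) - Real.pi / 4 * (μ₁ ^ 2 - 2)) =
        μ₁ ^ 2 * μ₂ ^ 2 * ν₁ / (8 * s) := by
      rw [m₁, m₂, hμ₁, hν₁, hπs]
      field_simp
      ring
    have n₂ : (s + 1) / (4 * s) / μ₂ * ((μ₂ ^ 2 - 1) - Real.pi / 4 * (μ₂ ^ 2 - 2)) =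
        μ₁ ^ 2 * μ₂ ^ 2 * ν₂ / (8 * s) := by
      have : 1 - s ≠ 0 := by linarith
      rw [m₁, m₂, hμ₂, hν₂, hπs]
      field_simp
      ring
    rw [hI, n₁, n₂, hD]
    field_simp
    ring
  -- A non-positive `D` would make the left side of `hcond` non-positive.
  have hDpos : 0 < D := by
    by_contra! h
    exact absurd hcond (not_lt.2 ((mul_nonpos_of_nonneg_of_nonpos (by positivity)
      (inv_nonpos.2 h)).trans zero_le_one))
  rw [gt_iff_lt, ← div_eq_mul_inv, one_lt_div hDpos] at hcond
  -- The energy quotient `k² + D / (8 φ s k²)` is smallest for `k⁴ = D / (8 φ s)`.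
  obtain ⟨k, hk, hk4⟩ : ∃ k : ℝ, 0 < k ∧ k ^ 4 = D / (8 * φ * s) := by
    refine ⟨√√(D / (8 * φ * s)), by positivity, ?_⟩
    rw [show (4 : ℕ) = 2 * 2 by norm_num, pow_mul, Real.sq_sqrt (by positivity),
      Real.sq_sqrt (by positivity)]
  obtain ⟨p, hp, hp₁, hp₂⟩ :=
    MagneticWedge.exists_mem_graphSpace_of_angularDensity hk hφ₀ hφ₁.le hB hB' hc hc'
  refine MagneticWedge.exists_mem_discreteSpectrum hφ₁.le hp fun hΘ => ?_
  have hlt : 2 * k ^ 2 < MagneticWedge.thetaN φ := by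
    refine lt_of_pow_lt_pow_left₀ 2 hΘ ?_
    rw [mul_pow, ← pow_mul, hk4]
    norm_num
    rw [← mul_div_assoc, div_lt_iff₀ (by positivity)]
    linarith
  have hen : ‖p.snd‖ ^ 2 = φ := by
    rw [hp₂, hID, hk4]
    field_simp
    ring
  rw [hen, hp₁, ← mul_div_assoc, lt_div_iff₀ (by positivity)]
  nlinarith
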